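/- Let $d\in\mathbb N$, $\beta\in(0,\infty)$, and let $v:[0,\infty)\to[0,\infty]$ be measurable with $\alpha(v)=\int_{\mathbb R^d}v(|x|)\,dx<\infty$. For $x,y\in\mathbb R^d$ let $\mu^{(\beta)}_{x,y}(A)=\mathbb P_x(B\in A;\,B_\beta\in dy)/dy$ be the canonical Brownian bridge measure on continuous paths $[0,\beta]\to\mathbb R^d$, where under $\mathbb P_x$ the process $B$ is a Brownian motion with generator $\Delta$ started at $x$; it has total mass $g_\beta(x,y)=(4\pi\beta)^{-d/2}e^{-|x-y|^2/(4\beta)}$. For a measurable set $\Lambda\subset\mathbb R^d$ with $0<|\Lambda|<\infty$ and $N\in\mathbb N_0$ let $$Z_N(\beta,\Lambda)=\frac1{N!}\sum_{\sigma\in\mathfrak S_N}\int_\Lambda dx_1\cdots\int_\Lambda dx_N\ \bigotimes_{i=1}^N\mu^{(\beta)}_{x_i,x_{\sigma(i)}}\Bigl[\exp\Bigl\{-\sum_{1\le i<j\le N}\int_0^\beta v\bigl(|B^{(i)}_s-B^{(j)}_s|\bigr)\,ds\Bigr\}\Bigr]$$ be the partition function with empty boundary condition, where $\mathfrak S_N$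 is the set of permutations of $1,\dots,N$ and $Z_0(\beta,\Lambda)=1$. Then, for every $N\in\mathbb N_0$, one has $0<Z_N(\beta,\Lambda)<\infty$ and $$\frac{Z_{N+1}(\beta,\Lambda)}{Z_N(\beta,\Lambda)}\ \ge\ (4\pi\beta)^{-d/2}\,\frac{|\Lambda|}{N+1}\,e^{-N\beta\alpha(v)/|\Lambda|}.$$ -/

import Mathlib

open MeasureTheory
open scoped NNReal ENNReal

namespace BoseGas

open ProbabilityTheory Filter Topology

/-- The space of continuous paths `T → E`, with the `σ`-algebra generated by the evaluations (which
for compact `T` and separable metric `E` is the Borel `σ`-algebra of uniform convergence). -/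
abbrev PathSpace (T E : Type*) [TopologicalSpace T] [TopologicalSpace E] : Type _ :=
  {w : T → E // Continuous w}

/-! ### Existence of Wiener measure

Nothing in this section is used later except `exists_wienerMeasure`. -/

namespace Construction

/-- The tent function on `[0, 1]`, with peak `1 / 2` at `1 / 2`. -/
noncomputable def tent (u : ℝ) : ℝ := max 0 (1 / 2 - |u - 1 / 2|)

lemma tent_eq_zero {u : ℝ} (h : u ≤ 0 ∨ 1 ≤ u) : tent u = 0 := by
  unfold tent
  apply max_eq_left
  rcases h with h | h
  · rw [abs_of_nonpos (by linarith)]; linarith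
  · rw [abs_of_nonneg (by linarith)]; linarith

lemma tent_nonneg (u : ℝ) : 0 ≤ tent u := le_max_left _ _
lemma tent_le_one (u : ℝ) : tent u ≤ 1 := max_le (by norm_num) (by linarith [abs_nonneg (u - 1/2)])

lemma continuous_tent : Continuous tent := by unfold tent; fun_prop

/-- `s (1 - t)` for `0 ≤ s ≤ t ≤ 1`, the covariance of the standard Brownian bridge. -/
noncomputable def cov1 (s t : ℝ) : ℝ := max 0 (min s t) * max 0 (1 - max s t)

lemma cov1_rec (s t : ℝ) : cov1 s t = tent s * tent t +
    1 / 2 * (cov1 (2 * s) (2 * t) + cov1 (2 * s - 1) (2 * t - 1)) := by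
  wlog h : s ≤ t generalizing s t
  · have := this t s (le_of_not_ge h)
    unfold cov1 at *
    simp only [min_comm t, max_comm t, min_comm (2 * t), max_comm (2 * t), min_comm (2 * t - 1),
      max_comm (2 * t - 1)] at this
    rw [this]; ring
  unfold cov1
  rw [min_eq_left h, max_eq_right h, min_eq_left (by linarith : 2 * s ≤ 2 * t),
    max_eq_right (by linarith : 2 * s ≤ 2 * t), min_eq_left (by linarith : 2 * s - 1 ≤ 2 * t - 1),
    max_eq_right (by linarith : 2 * s - 1 ≤ 2 * t - 1)]
  rcases le_total s 0 with hs | hs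
  · rw [tent_eq_zero (Or.inl hs), max_eq_left hs, max_eq_left (by linarith : 2 * s ≤ 0),
      max_eq_left (by linarith : 2 * s - 1 ≤ 0)]; ring
  rcases le_total 1 t with ht | ht
  · rw [tent_eq_zero (Or.inr ht), max_eq_left (by linarith : 1 - t ≤ 0),
      max_eq_left (by linarith : 1 - 2 * t ≤ 0), max_eq_left (by linarith : 1 - (2 * t - 1) ≤ 0)]
    ring
  unfold tent
  rw [max_eq_right (by linarith : 0 ≤ 1 - t), max_eq_right hs,
    max_eq_right (by linarith : 0 ≤ 2 * s), max_eq_right (by linarith : 0 ≤ 1 - (2 * t - 1))]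
  rcases le_total s (1 / 2) with h1 | h1 <;> rcases le_total t (1 / 2) with h2 | h2
  · rw [abs_of_nonpos (by linarith : s - 1 / 2 ≤ 0), abs_of_nonpos (by linarith : t - 1 / 2 ≤ 0),
      max_eq_right (by linarith), max_eq_right (by linarith), max_eq_right (by linarith),
      max_eq_left (by linarith : 2 * s - 1 ≤ 0)]
    ring
  · rw [abs_of_nonpos (by linarith : s - 1 / 2 ≤ 0), abs_of_nonneg (by linarith : 0 ≤ t - 1 / 2),
      max_eq_right (by linarith), max_eq_right (by linarith),
      max_eq_left (by linarith : 1 - 2 * t ≤ 0),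
      max_eq_left (by linarith : 2 * s - 1 ≤ 0)]
    ring
  · have : s = 1 / 2 := by linarith
    have : t = 1 / 2 := by linarith
    subst s t; norm_num
  · rw [abs_of_nonneg (by linarith : 0 ≤ s - 1 / 2), abs_of_nonneg (by linarith : 0 ≤ t - 1 / 2),
      max_eq_right (by linarith), max_eq_right (by linarith),
      max_eq_left (by linarith : 1 - 2 * t ≤ 0),
      max_eq_right (by linarith : 0 ≤ 2 * s - 1)]
    ring

lemma cov1_nonneg (s t : ℝ) : 0 ≤ cov1 s t := by unfold cov1; positivity

lemma cov1_eq_zero {s t : ℝ} (h : s ≤ 0 ∨ 1 ≤ s) : cov1 s t = 0 := by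
  unfold cov1
  rcases h with h | h
  · rw [max_eq_left ((min_le_left s t).trans h), zero_mul]
  · rw [max_eq_left (by linarith [le_max_left s t] : 1 - max s t ≤ 0), mul_zero]

lemma cov1_le_one (s t : ℝ) : cov1 s t ≤ 1 := by
  by_cases h : s ≤ 0 ∨ 1 ≤ s
  · rw [cov1_eq_zero h]; norm_num
  push Not at h
  unfold cov1
  have h1 : max 0 (min s t) ≤ 1 := max_le (by norm_num) ((min_le_left s t).trans h.2.le)
  have h2 : max 0 (1 - max s t) ≤ 1 := max_le (by norm_num) (by linarith [le_max_left s t, h.1])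
  exact mul_le_one₀ h1 (le_max_left _ _) h2

lemma cov1_of_le {s t : ℝ} (h0 : 0 ≤ s) (h : s ≤ t) (h1 : t ≤ 1) : cov1 s t = s * (1 - t) := by
  unfold cov1
  rw [min_eq_left h, max_eq_right h, max_eq_right h0, max_eq_right (by linarith)]

lemma sum_supp {f : ℝ → ℝ} (hf : ∀ u, u ≤ 0 ∨ 1 ≤ u → f u = 0) (hf1 : ∀ u, |f u| ≤ 1)
    (c : ℕ → ℝ) (C : ℝ) (hC : 0 ≤ C) (N : ℕ) (hc : ∀ k < N, |c k| ≤ C) (x : ℝ) :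
    |∑ k ∈ Finset.range N, c k * f (x - k)| ≤ C := by
  have key : ∀ k ∈ Finset.range N, k ≠ ⌊x⌋₊ → c k * f (x - k) = 0 := by
    intro k _ hk
    rw [hf, mul_zero]
    by_contra! h
    apply hk
    symm
    rw [Nat.floor_eq_iff (by have := Nat.cast_nonneg (α := ℝ) k; linarith)]
    constructor <;> linarith
  by_cases hm : ⌊x⌋₊ ∈ Finset.range N
  · rw [Finset.sum_eq_single_of_mem _ hm key, abs_mul]
    have := hc _ (Finset.mem_range.1 hm)
    calc _ ≤ C * 1 := by gcongr; exact hf1 _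
      _ = C := mul_one C
  · rw [Finset.sum_eq_zero fun k hk ↦ key k hk (by rintro rfl; exact hm hk)]
    simpa using hC

lemma cov1_partial (s t : ℝ) (N : ℕ) : cov1 s t =
    ∑ n ∈ Finset.range N, (1 / 2 : ℝ) ^ n *
      ∑ k ∈ Finset.range (2 ^ n), tent (2 ^ n * s - k) * tent (2 ^ n * t - k) +
    (1 / 2 : ℝ) ^ N * ∑ k ∈ Finset.range (2 ^ N), cov1 (2 ^ N * s - k) (2 ^ N * t - k) := by
  induction N with
  | zero => simp
  | succ N ih =>
    have h2 : ∀ (f : ℕ → ℝ) (M : ℕ), ∑ k ∈ Finset.range (2 * M), f k =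
        ∑ k ∈ Finset.range M, (f (2 * k) + f (2 * k + 1)) := by
      intro f M
      induction M with
      | zero => simp
      | succ M ih =>
        rw [mul_add, Finset.sum_range_succ, Finset.sum_range_succ, ih,
          Finset.sum_range_succ _ M]; ring
    have key : ∑ k ∈ Finset.range (2 ^ N), cov1 (2 ^ N * s - k) (2 ^ N * t - k) =
        ∑ k ∈ Finset.range (2 ^ N), tent (2 ^ N * s - k) * tent (2 ^ N * t - k) +
        1 / 2 * ∑ k ∈ Finset.range (2 ^ (N + 1)),
          cov1 (2 ^ (N + 1) * s - k) (2 ^ (N + 1) * t - k) := by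
      rw [pow_succ 2 N, mul_comm (2 ^ N) 2, h2, Finset.mul_sum, ← Finset.sum_add_distrib]
      refine Finset.sum_congr rfl fun k _ ↦ ?_
      rw [cov1_rec]
      push_cast
      congr 3 <;> congr 1 <;> ring
    rw [ih, Finset.sum_range_succ, key]
    ring

lemma tendsto_cov1 (s t : ℝ) : Tendsto (fun N ↦ ∑ n ∈ Finset.range N, (1 / 2 : ℝ) ^ n *
      ∑ k ∈ Finset.range (2 ^ n), tent (2 ^ n * s - k) * tent (2 ^ n * t - k)) atTop
      (𝓝 (cov1 s t)) := by
  have : (fun N ↦ ∑ n ∈ Finset.range N, (1 / 2 : ℝ) ^ n *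
      ∑ k ∈ Finset.range (2 ^ n), tent (2 ^ n * s - k) * tent (2 ^ n * t - k)) =
      fun N ↦ cov1 s t - (1 / 2 : ℝ) ^ N *
        ∑ k ∈ Finset.range (2 ^ N), cov1 (2 ^ N * s - k) (2 ^ N * t - k) := by
    ext N; linarith [cov1_partial s t N]
  rw [this]
  have h0 : Tendsto (fun N : ℕ ↦ (1 / 2 : ℝ) ^ N *
        ∑ k ∈ Finset.range (2 ^ N), cov1 (2 ^ N * s - k) (2 ^ N * t - k)) atTop (𝓝 0) := by
    refine squeeze_zero_norm (a := fun N ↦ (1 / 2 : ℝ) ^ N) (fun N ↦ ?_)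
      (tendsto_pow_atTop_nhds_zero_of_lt_one (by norm_num) (by norm_num))
    rw [Real.norm_eq_abs, abs_mul, abs_of_nonneg (by positivity : (0:ℝ) ≤ (1/2) ^ N)]
    refine mul_le_of_le_one_right (by positivity) ?_
    have := sum_supp (f := fun u ↦ cov1 u (u + (2 ^ N * t - 2 ^ N * s)))
      (fun u hu ↦ cov1_eq_zero hu)
      (fun u ↦ by rw [abs_of_nonneg (cov1_nonneg _ _)]; exact cov1_le_one _ _)
      (fun _ ↦ 1) 1 (by norm_num) (2 ^ N) (by simp) (2 ^ N * s)
    simpa only [one_mul, sub_add_sub_comm, add_sub_cancel, sub_add_eq_add_sub] using this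
  simpa using tendsto_const_nhds.sub h0

/-- The law of a family of independent standard normal variables. -/
noncomputable abbrev gaussSeq : Measure (ℕ × ℕ → ℝ) := Measure.infinitePi fun _ ↦ gaussianReal 0 1

lemma map_sum_gaussSeq (F : Finset (ℕ × ℕ)) (c : ℕ × ℕ → ℝ) :
    gaussSeq.map (fun ω ↦ ∑ j ∈ F, c j * ω j) =
      gaussianReal 0 (∑ j ∈ F, NNReal.mk (c j ^ 2) (sq_nonneg _)) := by
  have hind : iIndepFun (fun (i : ℕ × ℕ) (ω : ℕ × ℕ → ℝ) ↦ c i * ω i) gaussSeq :=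
    iIndepFun_infinitePi (P := fun _ ↦ gaussianReal 0 1) (X := fun i x ↦ c i * x)
      (fun i ↦ by fun_prop)
  induction F using Finset.induction_on with
  | empty => simp [Measure.map_const]
  | insert j F hj ih =>
    have h1 : gaussSeq.map (fun ω ↦ c j * ω j) = gaussianReal 0 (NNReal.mk (c j ^ 2) (sq_nonneg _)) := by
      have : gaussSeq.map (fun ω ↦ ω j) = gaussianReal 0 1 :=
        Measure.infinitePi_map_eval (fun _ ↦ gaussianReal 0 1) j
      rw [show (fun ω : ℕ × ℕ → ℝ ↦ c j * ω j) = (fun x ↦ c j * x) ∘ fun ω ↦ ω j from rfl,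
        ← Measure.map_map (by fun_prop) (by fun_prop), this, gaussianReal_map_const_mul]
      simp
    have h2 := hind.indepFun_finsetSum_of_notMem (fun i ↦ by fun_prop) hj
    have h3 := gaussianReal_add_gaussianReal_of_indepFun h2.symm h1
      (by convert ih using 2; ext ω; simp)
    rw [Finset.sum_insert hj]
    convert h3 using 2
    · ext ω; simp [Finset.sum_insert hj]
    · simp

lemma map_limit_gaussSeq (F : ℕ → Finset (ℕ × ℕ)) (c : ℕ × ℕ → ℝ) (X : (ℕ × ℕ → ℝ) → ℝ)
    (hX : Measurable X)
    (hlim : ∀ᵐ ω ∂gaussSeq, Tendsto (fun N ↦ ∑ j ∈ F N, c j * ω j) atTop (𝓝 (X ω)))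
    (v : ℝ≥0) (hv : Tendsto (fun N ↦ ∑ j ∈ F N, c j ^ 2) atTop (𝓝 (v : ℝ))) :
    gaussSeq.map X = gaussianReal 0 v := by
  have : IsProbabilityMeasure (gaussSeq.map X) := Measure.isProbabilityMeasure_map hX.aemeasurable
  refine Measure.ext_of_charFun (funext fun u ↦ ?_)
  have h1 : Tendsto (fun N ↦ charFun (gaussSeq.map (fun ω ↦ ∑ j ∈ F N, c j * ω j)) u) atTop
      (𝓝 (charFun (gaussSeq.map X) u)) := by
    simp_rw [charFun_apply_real]
    rw [integral_map hX.aemeasurable (by fun_prop)]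
    have : ∀ N, ∫ x, Complex.exp (u * x * Complex.I) ∂(gaussSeq.map (fun ω ↦ ∑ j ∈ F N, c j * ω j))
        = ∫ ω, Complex.exp (u * (∑ j ∈ F N, c j * ω j : ℝ) * Complex.I) ∂gaussSeq := fun N ↦ by
      rw [integral_map (Measurable.aemeasurable
        (Finset.measurable_sum _ fun i _ ↦ (measurable_pi_apply i).const_mul _)) (by fun_prop)]
    simp_rw [this]
    refine tendsto_integral_of_dominated_convergence (fun _ ↦ 1) (fun N ↦ ?_) (by simp) (fun N ↦ ?_) ?_
    · apply Measurable.aestronglyMeasurable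
      fun_prop
    · filter_upwards with ω
      rw [← Complex.ofReal_mul, Complex.norm_exp_ofReal_mul_I]
    · filter_upwards [hlim] with ω hω
      have hc : Continuous fun x : ℝ ↦ Complex.exp (u * x * Complex.I) := by fun_prop
      exact (hc.tendsto _).comp hω
  refine tendsto_nhds_unique h1 ?_
  simp_rw [map_sum_gaussSeq, charFun_gaussianReal]
  have hc : Continuous fun x : ℝ ↦ Complex.exp (u * (0 : ℝ) * Complex.I - x * u ^ 2 / 2) := by fun_prop
  have := (hc.tendsto _).comp hv
  convert this using 2 with N
  simp [NNReal.coe_sum]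

/-- The level `n` of the Lévy series of a Brownian bridge. -/
noncomputable def level (n : ℕ) (ω : ℕ × ℕ → ℝ) (t : ℝ) : ℝ :=
  (√2)⁻¹ ^ n * ∑ k ∈ Finset.range (2 ^ n), ω (n, k) * tent (2 ^ n * t - k)

/-- A random bound for the level `n`. -/
noncomputable def fourth (n : ℕ) (ω : ℕ × ℕ → ℝ) : ℝ :=
  (√2)⁻¹ ^ n * (4 / 5) ^ (3 * n) * ∑ k ∈ Finset.range (2 ^ n), ω (n, k) ^ 4

lemma fourth_nonneg (n : ℕ) (ω : ℕ × ℕ → ℝ) : 0 ≤ fourth n ω := by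
  unfold fourth; positivity

lemma abs_level_le (n : ℕ) (ω : ℕ × ℕ → ℝ) (t : ℝ) :
    |level n ω t| ≤ ((√2)⁻¹ * (5 / 4)) ^ n + fourth n ω := by
  unfold level fourth
  rw [abs_mul, abs_of_nonneg (by positivity : (0 : ℝ) ≤ (√2)⁻¹ ^ n), mul_pow, mul_assoc, ← mul_add]
  gcongr
  refine sum_supp (fun u hu ↦ tent_eq_zero hu)
    (fun u ↦ by rw [abs_of_nonneg (tent_nonneg u)]; exact tent_le_one u) _ _ (by positivity) _ ?_ _
  intro k hk
  have h1 : ω (n, k) ^ 4 ≤ ∑ k ∈ Finset.range (2 ^ n), ω (n, k) ^ 4 :=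
    Finset.single_le_sum (f := fun k ↦ ω (n, k) ^ 4) (fun _ _ ↦ by positivity)
      (Finset.mem_range.2 hk)
  refine le_trans ?_ (add_le_add_right (mul_le_mul_of_nonneg_left h1 (by positivity)) _)
  set lam : ℝ := (5 / 4) ^ n with hlam
  have hl : 0 < lam := by positivity
  have hinv : ((4 : ℝ) / 5) ^ (3 * n) = (lam⁻¹) ^ 3 := by
    rw [hlam, ← inv_pow, ← pow_mul, mul_comm n 3]; norm_num
  rw [hinv]
  rcases le_total |ω (n, k)| lam with h | h
  · have : 0 ≤ lam⁻¹ ^ 3 * ω (n, k) ^ 4 := by positivity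
    linarith
  · have h4 : ω (n, k) ^ 4 = |ω (n, k)| ^ 4 := by
      rw [← abs_pow, abs_of_nonneg (by positivity)]
    rw [h4]
    have : |ω (n, k)| ≤ lam⁻¹ ^ 3 * |ω (n, k)| ^ 4 := by
      calc |ω (n, k)| = lam⁻¹ ^ 3 * (lam ^ 3 * |ω (n, k)|) := by field_simp
        _ ≤ lam⁻¹ ^ 3 * (|ω (n, k)| ^ 3 * |ω (n, k)|) := by gcongr
        _ = _ := by ring
    linarith

lemma sqrt_two_inv_bounds : (√2)⁻¹ * (5 / 4) < 1 ∧ (√2)⁻¹ * (128 / 125) < 1 := by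
  have h : (5 / 4 : ℝ) < √2 := Real.lt_sqrt_of_sq_lt (by norm_num)
  have h0 : 0 < √2 := by positivity
  constructor <;> rw [inv_mul_lt_iff₀ h0] <;> linarith

/-- An almost sure event on which the Lévy series converges uniformly. -/
def good : Set (ℕ × ℕ → ℝ) := {ω | ∑' n, ENNReal.ofReal (fourth n ω) ≠ ∞}

lemma measurable_fourth (n : ℕ) : Measurable (fourth n) := by unfold fourth; fun_prop

lemma measurableSet_good : MeasurableSet good := by
  have : Measurable fun ω ↦ ∑' n, ENNReal.ofReal (fourth n ω) :=
    Measurable.tsum fun n ↦ (measurable_fourth n).ennreal_ofReal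
  exact this (measurableSet_singleton _).compl

lemma ae_good : ∀ᵐ ω ∂gaussSeq, ω ∈ good := by
  have hmeas : Measurable fun ω ↦ ∑' n, ENNReal.ofReal (fourth n ω) :=
    Measurable.tsum fun n ↦ (measurable_fourth n).ennreal_ofReal
  suffices h : ∫⁻ ω, ∑' n, ENNReal.ofReal (fourth n ω) ∂gaussSeq ≠ ∞ by
    filter_upwards [ae_lt_top hmeas h] with ω hω using hω.ne
  rw [lintegral_tsum fun n ↦ (measurable_fourth n).ennreal_ofReal.aemeasurable]
  set C : ℝ≥0∞ := ∫⁻ x, ENNReal.ofReal (x ^ 4) ∂gaussianReal 0 1 with hC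
  have hCtop : C ≠ ∞ := by
    have h := (memLp_id_gaussianReal (μ := 0) (v := 1) 4).integrable_norm_pow (p := 4) (by norm_num)
    have : ∀ x : ℝ, ENNReal.ofReal (x ^ 4) = ‖‖id x‖ ^ 4‖ₑ := fun x ↦ by
      rw [Real.enorm_eq_ofReal (by positivity), id, Real.norm_eq_abs, ← abs_pow,
        abs_of_nonneg (by positivity)]
    rw [hC]; simp_rw [this]
    exact h.2.ne
  have hn : ∀ n, ∫⁻ ω, ENNReal.ofReal (fourth n ω) ∂gaussSeq =
      ENNReal.ofReal (((√2)⁻¹ * (128 / 125)) ^ n) * C := by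
    intro n
    unfold fourth
    simp_rw [ENNReal.ofReal_mul (show 0 ≤ (√2)⁻¹ ^ n * (4 / 5 : ℝ) ^ (3 * n) by positivity)]
    rw [lintegral_const_mul _ (by fun_prop)]
    have hs : ∀ ω : ℕ × ℕ → ℝ, ENNReal.ofReal (∑ k ∈ Finset.range (2 ^ n), ω (n, k) ^ 4) =
        ∑ k ∈ Finset.range (2 ^ n), ENNReal.ofReal (ω (n, k) ^ 4) := fun ω ↦
      ENNReal.ofReal_sum_of_nonneg fun k _ ↦ by positivity
    simp_rw [hs]
    rw [lintegral_finsetSum _ (by fun_prop)]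
    have : ∀ k, ∫⁻ ω, ENNReal.ofReal (ω (n, k) ^ 4) ∂gaussSeq = C := fun k ↦ by
      have hm : gaussSeq.map (fun ω ↦ ω (n, k)) = gaussianReal 0 1 :=
        Measure.infinitePi_map_eval (fun _ ↦ gaussianReal 0 1) (n, k)
      rw [hC, ← hm, lintegral_map (by fun_prop) (by fun_prop)]
    simp_rw [this]
    rw [Finset.sum_const, Finset.card_range, nsmul_eq_mul, ← mul_assoc]
    congr 1
    rw [show (((2 ^ n : ℕ) : ℝ≥0∞)) = ENNReal.ofReal (2 ^ n) by simp [ENNReal.ofReal_pow],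
      ← ENNReal.ofReal_mul (by positivity)]
    congr 1
    rw [pow_mul, mul_assoc, ← mul_pow, ← mul_pow]
    norm_num
  simp_rw [hn]
  rw [ENNReal.tsum_mul_right]
  refine ENNReal.mul_ne_top ?_ hCtop
  rw [← ENNReal.ofReal_tsum_of_nonneg (fun n ↦ by positivity)
    (summable_geometric_of_lt_one (by positivity) sqrt_two_inv_bounds.2)]
  exact ENNReal.ofReal_ne_top

lemma summable_bound {ω : ℕ × ℕ → ℝ} (h : ω ∈ good) :
    Summable fun n ↦ ((√2)⁻¹ * (5 / 4)) ^ n + fourth n ω := by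
  refine (summable_geometric_of_lt_one (by positivity) sqrt_two_inv_bounds.1).add ?_
  have := ENNReal.summable_toReal h
  simpa [ENNReal.toReal_ofReal (fourth_nonneg _ _)] using this

open Classical in
/-- The sum of the Lévy series, a standard Brownian bridge on `[0, 1]`. -/
noncomputable def levy (ω : ℕ × ℕ → ℝ) (t : ℝ) : ℝ := if ω ∈ good then ∑' n, level n ω t else 0

lemma continuous_level (n : ℕ) (ω : ℕ × ℕ → ℝ) : Continuous (level n ω) := by
  unfold level
  have := continuous_tent
  fun_prop

lemma continuous_levy (ω : ℕ × ℕ → ℝ) : Continuous (levy ω) := by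
  unfold levy
  by_cases h : ω ∈ good
  · simp only [h, if_true]
    exact continuous_tsum (continuous_level · ω) (summable_bound h) fun n t ↦ abs_level_le n ω t
  · simp only [h, if_false]
    exact continuous_const

lemma tendsto_levy {ω : ℕ × ℕ → ℝ} (h : ω ∈ good) (t : ℝ) :
    Tendsto (fun N ↦ ∑ n ∈ Finset.range N, level n ω t) atTop (𝓝 (levy ω t)) := by
  unfold levy
  simp only [h, if_true]
  exact (Summable.of_norm_bounded (summable_bound h)
    fun n ↦ abs_level_le n ω t).hasSum.tendsto_sum_nat

lemma measurable_levy (t : ℝ) : Measurable fun ω ↦ levy ω t := by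
  classical
  refine measurable_of_tendsto_metrizable
    (f := fun N ↦ good.indicator fun ω ↦ ∑ n ∈ Finset.range N, level n ω t) (fun N ↦ ?_) ?_
  · refine Measurable.indicator ?_ measurableSet_good
    unfold level
    fun_prop
  · rw [tendsto_pi_nhds]
    intro ω
    by_cases h : ω ∈ good
    · simpa [h] using tendsto_levy h t
    · simp [h, levy]

/-- A standard Brownian motion, obtained from a bridge by a time change. -/
noncomputable def bm (t : ℝ≥0) (ω : ℕ × ℕ → ℝ) : ℝ := (1 + t) * levy ω (t / (1 + t))

lemma cov1_bm (s t : ℝ≥0) :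
    (1 + s) * (1 + t) * cov1 (s / (1 + s)) (t / (1 + t)) = (min s t : ℝ≥0) := by
  wlog h : s ≤ t generalizing s t
  · have := this t s (le_of_not_ge h)
    rw [min_comm, ← this]
    unfold cov1
    rw [min_comm (s / (1 + s) : ℝ), max_comm (s / (1 + s) : ℝ)]; ring
  have hs : (0 : ℝ) ≤ s := s.2
  have ht : (0 : ℝ) ≤ t := t.2
  have hst : (s : ℝ) ≤ t := h
  rw [min_eq_left h, cov1_of_le (by positivity)
    (by rw [div_le_div_iff₀ (by positivity) (by positivity)]; nlinarith)
    (by rw [div_le_one (by positivity)]; linarith)]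
  field_simp
  ring

lemma law_comb {ι : Type*} [Fintype ι] (τ : ι → ℝ≥0) (a : ι → ℝ) (v : ℝ≥0)
    (hv : ∑ i, ∑ j, a i * a j * (min (τ i) (τ j) : ℝ≥0) = (v : ℝ)) :
    gaussSeq.map (fun ω ↦ ∑ i, a i * bm (τ i) ω) = gaussianReal 0 v := by
  set c : ℕ × ℕ → ℝ := fun p ↦ (√2)⁻¹ ^ p.1 *
    ∑ i, a i * (1 + (τ i)) * tent (2 ^ p.1 * (τ i / (1 + (τ i))) - p.2) with hc
  refine map_limit_gaussSeq (fun N ↦ (Finset.range N).sigma (fun n ↦ Finset.range (2 ^ n)) |>.map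
    (Equiv.sigmaEquivProd ℕ ℕ).toEmbedding) c _ ?_ ?_ v ?_
  · refine Finset.measurable_sum _ fun i _ ↦ ?_
    unfold bm
    have := measurable_levy (τ i / (1 + (τ i)))
    fun_prop
  · filter_upwards [ae_good] with ω hω
    have h1 : Tendsto (fun N ↦ ∑ i : ι, a i * ((1 + (τ i)) * ∑ n ∈ Finset.range N,
        level n ω (τ i / (1 + (τ i))))) atTop (𝓝 (∑ i : ι, a i * bm (τ i) ω)) :=
      tendsto_finsetSum _ fun i _ ↦ ((tendsto_levy hω _).const_mul _).const_mul _
    convert h1 using 2 with N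
    rw [Finset.sum_map, Finset.sum_sigma]
    simp_rw [hc, level, Finset.mul_sum, Finset.sum_mul]
    symm
    rw [Finset.sum_comm]
    refine Finset.sum_congr rfl fun n _ ↦ ?_
    rw [Finset.sum_comm]
    refine Finset.sum_congr rfl fun k _ ↦ Finset.sum_congr rfl fun i _ ↦ ?_
    simp
    ring
  · rw [← hv]
    have h1 : Tendsto (fun N ↦ ∑ i : ι, ∑ j : ι, a i * a j * ((1 + (τ i)) * (1 + (τ j)) *
        ∑ n ∈ Finset.range N, (1 / 2 : ℝ) ^ n *
          ∑ k ∈ Finset.range (2 ^ n), tent (2 ^ n * (τ i / (1 + (τ i))) - k) *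
            tent (2 ^ n * (τ j / (1 + (τ j))) - k))) atTop
        (𝓝 (∑ i : ι, ∑ j : ι, a i * a j * (min (τ i) (τ j) : ℝ≥0))) := by
      refine tendsto_finsetSum _ fun i _ ↦ tendsto_finsetSum _ fun j _ ↦ ?_
      rw [← cov1_bm]
      exact ((tendsto_cov1 _ _).const_mul _).const_mul _
    convert h1 using 2 with N
    rw [Finset.sum_map, Finset.sum_sigma]
    have hsq : ∀ n : ℕ, ((√2)⁻¹ ^ n) ^ 2 = (1 / 2 : ℝ) ^ n := fun n ↦ by
      rw [← pow_mul, mul_comm, pow_mul, inv_pow, Real.sq_sqrt (by norm_num)]; norm_num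
    simp only [Finset.mul_sum]
    rw [Finset.sum_congr rfl fun i _ ↦ Finset.sum_comm, Finset.sum_comm]
    refine Finset.sum_congr rfl fun n _ ↦ ?_
    rw [Finset.sum_congr rfl fun i _ ↦ Finset.sum_comm, Finset.sum_comm]
    refine Finset.sum_congr rfl fun k _ ↦ ?_
    simp only [hc, Equiv.toEmbedding_apply, Equiv.sigmaEquivProd_apply]
    rw [mul_pow, hsq, sq, Finset.sum_mul_sum, Finset.mul_sum]
    refine Finset.sum_congr rfl fun i _ ↦ ?_
    rw [Finset.mul_sum]
    refine Finset.sum_congr rfl fun j _ ↦ ?_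
    ring

lemma measurable_bm (t : ℝ≥0) : Measurable (bm t) := by
  unfold bm
  have := measurable_levy (t / (1 + t))
  fun_prop

lemma isGaussianProcess_bm : IsGaussianProcess bm gaussSeq where
  hasGaussianLaw I := by
    have hm : Measurable fun ω ↦ I.restrict (bm · ω) :=
      measurable_pi_lambda _ fun i ↦ measurable_bm i
    refine ⟨isGaussian_of_map_eq_gaussianReal fun L ↦ ⟨0, ?_⟩⟩
    have hL : ∀ x : I → ℝ, L x = ∑ i, L (Pi.single i 1) * x i := fun x ↦ by
      conv_lhs => rw [← LinearMap.sum_single_apply (fun _ : I ↦ ℝ) x, map_sum]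
      refine Finset.sum_congr rfl fun i _ ↦ ?_
      rw [mul_comm, ← smul_eq_mul, ← map_smul, ← Pi.single_smul, smul_eq_mul, mul_one]
    have hpos : 0 ≤ ∑ i : I, ∑ j : I,
        L (Pi.single i 1) * L (Pi.single j 1) * (min i.1 j.1 : ℝ≥0) := by
      have h := (BrownianReal.posSemidef_covMatrix I).dotProduct_mulVec_nonneg
        (fun i ↦ L (Pi.single i 1))
      simp only [dotProduct, Matrix.mulVec, BrownianReal.covMatrix_apply, Finset.mul_sum,
        Pi.star_apply, star_trivial] at h
      refine h.trans_eq (Finset.sum_congr rfl fun i _ ↦ Finset.sum_congr rfl fun j _ ↦ ?_)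
      ring
    refine ⟨⟨_, hpos⟩, ?_⟩
    rw [Measure.map_map (by fun_prop) hm]
    convert law_comb (fun i : I ↦ i.1) (fun i ↦ L (Pi.single i 1)) ⟨_, hpos⟩ rfl using 2
    ext ω
    rw [Function.comp, hL]
    rfl

lemma hasLaw_bm (t : ℝ≥0) : gaussSeq.map (bm t) = gaussianReal 0 t := by
  convert law_comb (fun _ : Unit ↦ t) (fun _ ↦ 1) t (by simp) using 2
  ext ω; simp

lemma isPreBrownianReal_bm : IsPreBrownianReal bm gaussSeq := by
  have hmean : ∀ t, gaussSeq[bm t] = 0 := fun t ↦ by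
    rw [← integral_id_gaussianReal (μ := 0) (v := t), ← hasLaw_bm t,
      integral_map (measurable_bm t).aemeasurable (by fun_prop)]
  have hvar : ∀ t, Var[bm t; gaussSeq] = t := fun t ↦ by
    rw [← variance_id_gaussianReal (μ := 0) (v := t), ← hasLaw_bm t,
      variance_map (by fun_prop) (measurable_bm t).aemeasurable]
    rfl
  refine isGaussianProcess_bm.isPreBrownianReal_of_covariance hmean fun s t hst ↦ ?_
  have hL2 : ∀ t, MemLp (bm t) 2 gaussSeq := fun t ↦
    (isGaussianProcess_bm.hasGaussianLaw_eval t).memLp_two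
  have hsum : gaussSeq.map (bm s + bm t) = gaussianReal 0 (3 * s + t) := by
    convert law_comb (fun b : Bool ↦ if b then s else t) (fun _ ↦ 1) (3 * s + t) ?_ using 2
    · ext ω; simp
    · simp [hst]; ring
  have hvs : Var[bm s + bm t; gaussSeq] = (3 * s + t : ℝ≥0) := by
    rw [← variance_id_gaussianReal (μ := 0) (v := 3 * s + t), ← hsum,
      variance_map (by fun_prop) ((measurable_bm s).add (measurable_bm t)).aemeasurable]
    rfl
  rw [variance_add (hL2 s) (hL2 t), hvar, hvar] at hvs
  push_cast at hvs
  linarith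

lemma continuous_bm (ω : ℕ × ℕ → ℝ) : Continuous (bm · ω) := by
  have h := continuous_levy ω
  have h1 : Continuous fun t : ℝ≥0 ↦ (t : ℝ) / (1 + t) :=
    NNReal.continuous_coe.div (by fun_prop) fun t ↦ by positivity
  exact (continuous_const.add NNReal.continuous_coe).mul (h.comp h1)

theorem exists_wienerMeasure : ∃ μ : Measure (PathSpace ℝ≥0 ℝ),
    IsBrownianReal (fun t w ↦ w.1 t) μ := by
  have hm : Measurable fun ω ↦ (⟨(bm · ω), continuous_bm ω⟩ : PathSpace ℝ≥0 ℝ) :=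
    Measurable.subtype_mk (measurable_pi_lambda _ fun t ↦ measurable_bm t)
  have hr : ∀ I : Finset ℝ≥0, Measurable fun w : PathSpace ℝ≥0 ℝ ↦ I.restrict (fun t ↦ w.1 t) :=
    fun I ↦ measurable_pi_lambda _ fun i ↦ (measurable_pi_apply i.1).comp measurable_subtype_coe
  refine ⟨gaussSeq.map fun ω ↦ ⟨(bm · ω), continuous_bm ω⟩, ⟨⟨fun I ↦ ⟨(hr I).aemeasurable, ?_⟩⟩, ?_⟩⟩
  · rw [Measure.map_map (hr I) hm]
    exact (isPreBrownianReal_bm.hasLaw I).map_eq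
  · exact .of_forall fun w ↦ w.2

end Construction

/-! ### Brownian motion and Brownian bridge in `ℝ^d` -/

/-- One-dimensional Wiener measure: the law on the continuous functions `[0, ∞) → ℝ` under which
the coordinate process is a standard Brownian motion. -/
noncomputable def wienerMeasure : Measure (PathSpace ℝ≥0 ℝ) := Construction.exists_wienerMeasure.choose

theorem isBrownianReal_wienerMeasure : IsBrownianReal (fun t w ↦ w.1 t) wienerMeasure :=
  Construction.exists_wienerMeasure.choose_spec

instance : IsProbabilityMeasure wienerMeasure :=
  isBrownianReal_wienerMeasure.isGaussianProcess.isProbabilityMeasure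

/-- The law of `d` independent standard Brownian motions. -/
noncomputable abbrev wienerD (d : ℕ) : Measure (Fin d → PathSpace ℝ≥0 ℝ) :=
  Measure.pi fun _ ↦ wienerMeasure

/-- The value at time `t` of the Brownian motion in `ℝ^d` with generator `Δ` started at `0`. The
factor `√2` is due to the generator being `Δ` and not `Δ / 2`. -/
noncomputable def bmValue {d : ℕ} (w : Fin d → PathSpace ℝ≥0 ℝ) (t : ℝ≥0) :
    EuclideanSpace ℝ (Fin d) := √2 • WithLp.toLp 2 fun i ↦ (w i).1 t

lemma continuous_bmValue {d : ℕ} (w : Fin d → PathSpace ℝ≥0 ℝ) : Continuous (bmValue w) := by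
  unfold bmValue
  have := fun i ↦ (w i).2
  fun_prop

lemma measurable_bmValue {d : ℕ} (t : ℝ≥0) :
    Measurable fun w : Fin d → PathSpace ℝ≥0 ℝ ↦ bmValue w t := by
  unfold bmValue
  have : ∀ i, Measurable fun w : Fin d → PathSpace ℝ≥0 ℝ ↦ (w i).1 t := fun i ↦
    (measurable_pi_apply t).comp (measurable_subtype_coe.comp (measurable_pi_apply i))
  exact ((WithLp.measurable_toLp 2 _).comp (measurable_pi_lambda _ this)).const_smul √2

/-- The Brownian motion with generator `Δ` started at `x`, on the time interval `[0, β]`. -/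
noncomputable def brownianPath {d : ℕ} (β : ℝ) (x : EuclideanSpace ℝ (Fin d))
    (w : Fin d → PathSpace ℝ≥0 ℝ) : PathSpace (Set.Icc 0 β) (EuclideanSpace ℝ (Fin d)) :=
  ⟨fun s ↦ x + bmValue w s.1.toNNReal, by have := continuous_bmValue w; fun_prop⟩

/-- The Brownian motion with generator `Δ` pinned to be at `x` at time `0` and at `y` at time `β`:
`x + (s / β) (y - x) + W_s - (s / β) W_β`. -/
noncomputable def bridgePath {d : ℕ} (β : ℝ) (x y : EuclideanSpace ℝ (Fin d))
    (w : Fin d → PathSpace ℝ≥0 ℝ) : PathSpace (Set.Icc 0 β) (EuclideanSpace ℝ (Fin d)) :=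
  ⟨fun s ↦ x + (s.1 / β) • (y - x) +
      (bmValue w s.1.toNNReal - (s.1 / β) • bmValue w β.toNNReal), by
    have := continuous_bmValue w
    fun_prop⟩

/-- The Gaussian density `g_β(x, y) = (4 π β) ^ (-d / 2) exp (-|x - y| ^ 2 / (4 β))`. -/
noncomputable def heatKernel {d : ℕ} (β : ℝ) (x y : EuclideanSpace ℝ (Fin d)) : ℝ :=
  (4 * Real.pi * β) ^ (-(d : ℝ) / 2) * Real.exp (-(1 / (4 * β)) * ‖x - y‖ ^ 2)

/-- The canonical (unnormalized) Brownian bridge measure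
`μ_{x,y}^{(β)}(A) = P_x(B ∈ A; B_β ∈ dy) / dy`, of total mass `g_β(x, y)`. That it is the
disintegration of Brownian motion with respect to its end point is shown in
`brownianBridgeMeasure_disintegration`. -/
noncomputable def brownianBridgeMeasure {d : ℕ} (β : ℝ) (x y : EuclideanSpace ℝ (Fin d)) :
    Measure (PathSpace (Set.Icc 0 β) (EuclideanSpace ℝ (Fin d))) :=
  ENNReal.ofReal (heatKernel β x y) • (wienerD d).map (bridgePath β x y)

lemma measurable_brownianPath {d : ℕ} (β : ℝ) (x : EuclideanSpace ℝ (Fin d)) :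
    Measurable (brownianPath β x) := by
  refine Measurable.subtype_mk (measurable_pi_lambda _ fun s ↦ ?_)
  exact (measurable_bmValue _).const_add _

lemma measurable_bridgePath {d : ℕ} (β : ℝ) (x y : EuclideanSpace ℝ (Fin d)) :
    Measurable (bridgePath β x y) := by
  refine Measurable.subtype_mk (measurable_pi_lambda _ fun s ↦ ?_)
  have := measurable_bmValue (d := d)
  fun_prop

lemma measurable_coord (t : ℝ≥0) : Measurable fun w : PathSpace ℝ≥0 ℝ ↦ w.1 t :=
  (measurable_pi_apply t).comp measurable_subtype_coe

lemma indep_pinned {β : ℝ} (hβ : 0 < β) :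
    IndepFun (fun (w : PathSpace ℝ≥0 ℝ) (s : Set.Icc 0 β) ↦
        w.1 s.1.toNNReal - s.1 / β * w.1 β.toNNReal)
      (fun w ↦ w.1 β.toNNReal) wienerMeasure := by
  have hB := isBrownianReal_wienerMeasure.toIsPreBrownianReal
  have hG := hB.isGaussianProcess
  have h := IsGaussianProcess.indepFun_of_covariance_eq_zero (P := wienerMeasure)
    (X := fun (s : Set.Icc 0 β) (w : PathSpace ℝ≥0 ℝ) ↦
      w.1 s.1.toNNReal - s.1 / β * w.1 β.toNNReal)
    (Y := fun (_ : Unit) (w : PathSpace ℝ≥0 ℝ) ↦ w.1 β.toNNReal) ?_ ?_ ?_ ?_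
  · exact h.comp measurable_id (measurable_pi_apply ())
  · apply hG.of_isGaussianProcess
    rintro (s | u)
    · exact ⟨{s.1.toNNReal, β.toNNReal},
        { toFun x := x ⟨s.1.toNNReal, by simp⟩ - s.1 / β * x ⟨β.toNNReal, by simp⟩
          map_add' x y := by simp; ring
          map_smul' c x := by simp; ring }, by simp⟩
    · exact ⟨{β.toNNReal},
        { toFun x := x ⟨β.toNNReal, by simp⟩
          map_add' x y := by simp
          map_smul' c x := by simp }, by simp⟩
  · intro s
    exact ((measurable_coord _).sub ((measurable_coord _).const_mul _)).aemeasurable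
  · intro u
    exact (measurable_coord _).aemeasurable
  · intro s u
    have hL : ∀ t, MemLp (fun w : PathSpace ℝ≥0 ℝ ↦ w.1 t) 2 wienerMeasure := fun t ↦
      (hG.hasGaussianLaw_eval t).memLp_two
    rw [covariance_fun_sub_left (hL _) ((hL _).const_mul _) (hL _), covariance_const_mul_left]
    have hc := fun s t ↦ hB.covariance_fun_eval s t
    rw [hc, hc, min_self, min_eq_left (Real.toNNReal_le_toNNReal s.2.2),
      Real.coe_toNNReal _ s.2.1, Real.coe_toNNReal _ hβ.le]
    field_simp
    ring

lemma law_end {d : ℕ} {β : ℝ} (hβ : 0 < β) :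
    (Measure.pi fun _ : Fin d ↦ wienerMeasure.map fun w ↦ w.1 β.toNNReal).map
      (fun u ↦ √2 • WithLp.toLp 2 u) =
    (volume : Measure (EuclideanSpace ℝ (Fin d))).withDensity
      fun z ↦ ENNReal.ofReal (heatKernel β 0 z) := by
  have hB := isBrownianReal_wienerMeasure.toIsPreBrownianReal
  have hlaw : wienerMeasure.map (fun w ↦ w.1 β.toNNReal) = gaussianReal 0 β.toNNReal :=
    (hB.hasLaw_eval _).map_eq
  simp_rw [hlaw]
  set P := (Measure.pi fun _ : Fin d ↦ gaussianReal 0 β.toNNReal)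
  have hk0 : ∀ z : EuclideanSpace ℝ (Fin d), 0 ≤ heatKernel β 0 z := fun z ↦ by
    unfold heatKernel; positivity
  have hint : Integrable (fun z : EuclideanSpace ℝ (Fin d) ↦ heatKernel β 0 z) := by
    have h := GaussianFourier.integrable_cexp_neg_mul_sq_norm_add
      (V := EuclideanSpace ℝ (Fin d)) (b := ((1 / (4 * β) : ℝ) : ℂ))
      (by rw [Complex.ofReal_re]; positivity) 0 0
    refine (h.norm.const_mul ((4 * Real.pi * β) ^ (-(d : ℝ) / 2))).congr (.of_forall fun z ↦ ?_)
    simp only [heatKernel, zero_mul, add_zero, zero_sub, norm_neg]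
    rw [← Complex.ofReal_neg, ← Complex.ofReal_pow, ← Complex.ofReal_mul,
      Complex.norm_exp_ofReal]
  have : IsFiniteMeasure ((volume : Measure (EuclideanSpace ℝ (Fin d))).withDensity
      fun z ↦ ENNReal.ofReal (heatKernel β 0 z)) := isFiniteMeasure_withDensity_ofReal hint.2
  have hm : Measurable fun z : EuclideanSpace ℝ (Fin d) ↦ heatKernel β 0 z := by
    unfold heatKernel; fun_prop
  refine Measure.ext_of_charFun (funext fun t ↦ ?_)
  rw [charFun_map_smul_comp (f := WithLp.toLp 2) (by fun_prop), charFun_pi]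
  rw [charFun_apply, integral_withDensity_eq_integral_toReal_smul
    hm.ennreal_ofReal (by simp)]
  simp_rw [charFun_gaussianReal, ENNReal.toReal_ofReal (hk0 _)]
  have h2 : ∀ z : EuclideanSpace ℝ (Fin d), heatKernel β 0 z •
      Complex.exp (inner ℝ z t * Complex.I) = (((4 * Real.pi * β) ^ (-(d : ℝ) / 2) : ℝ) : ℂ) *
      Complex.exp (-((1 / (4 * β) : ℝ) : ℂ) * ‖z‖ ^ 2 + Complex.I * inner ℝ t z) := fun z ↦ by
    rw [Complex.exp_add, heatKernel, zero_sub, norm_neg, Complex.real_smul, real_inner_comm,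
      mul_comm Complex.I]
    push_cast
    ring
  simp_rw [h2]
  rw [integral_const_mul, GaussianFourier.integral_cexp_neg_mul_sq_norm_add
    (by rw [Complex.ofReal_re]; positivity)]
  have h3 : (Real.pi / ((1 / (4 * β) : ℝ) : ℂ)) ^
      ((Module.finrank ℝ (EuclideanSpace ℝ (Fin d)) : ℂ) / 2) =
      (((4 * Real.pi * β) ^ ((d : ℝ) / 2) : ℝ) : ℂ) := by
    rw [Complex.ofReal_cpow (by positivity)]
    simp
    congr 1
    field_simp
  rw [h3, ← mul_assoc, ← Complex.ofReal_mul, ← Real.rpow_add (by positivity),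
    show -(d : ℝ) / 2 + d / 2 = 0 by ring, Real.rpow_zero, Complex.ofReal_one, one_mul,
    ← Complex.exp_sum]
  congr 1
  simp only [PiLp.smul_apply, smul_eq_mul, Complex.ofReal_zero, mul_zero, zero_mul, zero_sub]
  have h4 : ∀ i, ((√2 * t i : ℝ) : ℂ) ^ 2 = ((2 * t i ^ 2 : ℝ) : ℂ) := fun i ↦ by
    rw [← Complex.ofReal_pow, mul_pow, Real.sq_sqrt (by norm_num)]
  simp_rw [h4]
  rw [← Complex.ofReal_pow ‖t‖, EuclideanSpace.real_norm_sq_eq, Complex.I_sq]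
  rw [show (((β.toNNReal : ℝ≥0) : ℝ) : ℂ) = (β : ℂ) by rw [Real.coe_toNNReal _ hβ.le]]
  have : (β : ℂ) ≠ 0 := by exact_mod_cast hβ.ne'
  push_cast
  rw [Finset.mul_sum, Finset.sum_div]
  refine Finset.sum_congr rfl fun i _ ↦ ?_
  field_simp

/-- The pinned path in dimension one. -/
noncomputable def pinned (β : ℝ) (w : PathSpace ℝ≥0 ℝ) : PathSpace (Set.Icc 0 β) ℝ :=
  ⟨fun s ↦ w.1 s.1.toNNReal - s.1 / β * w.1 β.toNNReal, by have := w.2; fun_prop⟩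

lemma measurable_pinned (β : ℝ) : Measurable (pinned β) :=
  Measurable.subtype_mk <| measurable_pi_lambda _ fun _ ↦
    (measurable_coord _).sub ((measurable_coord _).const_mul _)

lemma joint_law {d : ℕ} {β : ℝ} (hβ : 0 < β) :
    (wienerD d).map (fun w ↦ (bridgePath β 0 0 w, bmValue w β.toNNReal)) =
      ((wienerD d).map (bridgePath β 0 0)).prod
        ((wienerD d).map fun w ↦ bmValue w β.toNNReal) := by
  have hp := measurable_pinned β
  have he := measurable_coord β.toNNReal
  have h1 : IndepFun (pinned β) (fun w ↦ w.1 β.toNNReal) wienerMeasure := by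
    have h := indep_pinned hβ
    rw [IndepFun_iff_Indep] at h ⊢
    convert h using 1
    exact MeasurableSpace.comap_comp
  have h2 := (indepFun_iff_map_prod_eq_prod_map_map hp.aemeasurable he.aemeasurable).1 h1
  have := Measure.isProbabilityMeasure_map (μ := wienerMeasure) hp.aemeasurable
  have := Measure.isProbabilityMeasure_map (μ := wienerMeasure) he.aemeasurable
  have h3 : IndepFun (fun (w : Fin d → PathSpace ℝ≥0 ℝ) i ↦ pinned β (w i))
      (fun w i ↦ (w i).1 β.toNNReal) (wienerD d) := by
    have m1 : Measurable fun (w : Fin d → PathSpace ℝ≥0 ℝ) i ↦ pinned β (w i) :=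
      measurable_pi_lambda _ fun i ↦ hp.comp (measurable_pi_apply i)
    have m2 : Measurable fun (w : Fin d → PathSpace ℝ≥0 ℝ) i ↦ (w i).1 β.toNNReal :=
      measurable_pi_lambda _ fun i ↦ he.comp (measurable_pi_apply i)
    have m3 : Measurable fun (w : Fin d → PathSpace ℝ≥0 ℝ) i ↦
        (pinned β (w i), (w i).1 β.toNNReal) :=
      measurable_pi_lambda _ fun i ↦ (hp.prodMk he).comp (measurable_pi_apply i)
    rw [indepFun_iff_map_prod_eq_prod_map_map m1.aemeasurable m2.aemeasurable]
    rw [Measure.pi_map_pi (fun _ ↦ hp.aemeasurable),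
      Measure.pi_map_pi (f := fun _ (w : PathSpace ℝ≥0 ℝ) ↦ w.1 β.toNNReal) (fun _ ↦ he.aemeasurable),
      ← (measurePreserving_arrowProdEquivProdArrow _ _ (Fin d) _ _).map_eq, ← h2,
      ← Measure.pi_map_pi (fun _ ↦ (hp.prodMk he).aemeasurable),
      Measure.map_map (MeasurableEquiv.measurable _) m3]
    rfl
  let F : (Fin d → PathSpace (Set.Icc 0 β) ℝ) →
      PathSpace (Set.Icc 0 β) (EuclideanSpace ℝ (Fin d)) := fun f ↦
    ⟨fun s ↦ √2 • WithLp.toLp 2 fun i ↦ (f i).1 s, by have := fun i ↦ (f i).2; fun_prop⟩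
  have hF : Measurable F := by
    refine Measurable.subtype_mk (measurable_pi_lambda _ fun s ↦ ?_)
    refine ((WithLp.measurable_toLp 2 _).comp (measurable_pi_lambda _ fun i ↦ ?_)).const_smul √2
    exact (measurable_pi_apply s).comp (measurable_subtype_coe.comp (measurable_pi_apply i))
  have hG : Measurable fun u : Fin d → ℝ ↦ √2 • WithLp.toLp 2 u := by fun_prop
  have h4 := h3.comp hF hG
  rw [← (indepFun_iff_map_prod_eq_prod_map_map (measurable_bridgePath β 0 0).aemeasurable
    (measurable_bmValue _).aemeasurable)]
  have h5 : bridgePath β 0 0 = F ∘ fun (w : Fin d → PathSpace ℝ≥0 ℝ) i ↦ pinned β (w i) := by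
    ext w s i
    simp [bridgePath, F, pinned, bmValue]
    ring
  rw [h5]
  exact h4

/-- `P_x(B ∈ A, B_β ∈ D) = ∫_D μ_{x,y}^{(β)}(A) dy`. -/
theorem brownianBridgeMeasure_disintegration {d : ℕ} {β : ℝ} (hβ : 0 < β)
    (x : EuclideanSpace ℝ (Fin d))
    {A : Set (PathSpace (Set.Icc 0 β) (EuclideanSpace ℝ (Fin d)))} (hA : MeasurableSet A)
    {D : Set (EuclideanSpace ℝ (Fin d))} (hD : MeasurableSet D) :
    wienerD d {w | brownianPath β x w ∈ A ∧
      (brownianPath β x w).1 ⟨β, Set.right_mem_Icc.2 hβ.le⟩ ∈ D} =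
    ∫⁻ y in D, brownianBridgeMeasure β x y A := by
  classical
  have hlaw : (wienerD d).map (fun w ↦ bmValue w β.toNNReal) =
      (volume : Measure (EuclideanSpace ℝ (Fin d))).withDensity
        fun z ↦ ENNReal.ofReal (heatKernel β 0 z) := by
    have := Measure.isProbabilityMeasure_map (μ := wienerMeasure)
      (measurable_coord β.toNNReal).aemeasurable
    have m2 : Measurable fun (w : Fin d → PathSpace ℝ≥0 ℝ) i ↦ (w i).1 β.toNNReal :=
      measurable_pi_lambda _ fun i ↦ (measurable_coord _).comp (measurable_pi_apply i)
    rw [← law_end hβ, ← Measure.pi_map_pi (f := fun _ (w : PathSpace ℝ≥0 ℝ) ↦ w.1 β.toNNReal)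
      (fun _ ↦ (measurable_coord _).aemeasurable), Measure.map_map (by fun_prop) m2]
    rfl
  let Φ : PathSpace (Set.Icc 0 β) (EuclideanSpace ℝ (Fin d)) × EuclideanSpace ℝ (Fin d) →
      PathSpace (Set.Icc 0 β) (EuclideanSpace ℝ (Fin d)) := fun p ↦
    ⟨fun s ↦ x + (s.1 / β) • p.2 + p.1.1 s, by have := p.1.2; fun_prop⟩
  have hΦ : Measurable Φ := by
    refine Measurable.subtype_mk (measurable_pi_lambda _ fun s ↦ ?_)
    have : Measurable fun f : PathSpace (Set.Icc 0 β) (EuclideanSpace ℝ (Fin d)) ↦ f.1 s :=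
      (measurable_pi_apply s).comp measurable_subtype_coe
    have h1 : Measurable fun p : PathSpace (Set.Icc 0 β) (EuclideanSpace ℝ (Fin d)) ×
        EuclideanSpace ℝ (Fin d) ↦ x + (s.1 / β) • p.2 :=
      (measurable_snd.const_smul (s.1 / β)).const_add x
    have h2 : Measurable fun p : PathSpace (Set.Icc 0 β) (EuclideanSpace ℝ (Fin d)) ×
        EuclideanSpace ℝ (Fin d) ↦ p.1.1 s := this.comp measurable_fst
    exact h1.add h2
  let S : Set (PathSpace (Set.Icc 0 β) (EuclideanSpace ℝ (Fin d)) ×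
      EuclideanSpace ℝ (Fin d)) := Φ ⁻¹' A ∩ (fun p ↦ x + p.2) ⁻¹' D
  have hS : MeasurableSet S := (hΦ hA).inter ((measurable_snd.const_add x) hD)
  have hend := measurable_bmValue (d := d) β.toNNReal
  have hb := measurable_bridgePath (d := d) β 0 0
  have h1 : {w | brownianPath β x w ∈ A ∧
      (brownianPath β x w).1 ⟨β, Set.right_mem_Icc.2 hβ.le⟩ ∈ D} =
      (fun w ↦ (bridgePath β 0 0 w, bmValue w β.toNNReal)) ⁻¹' S := by
    ext w
    have : brownianPath β x w = Φ (bridgePath β 0 0 w, bmValue w β.toNNReal) := by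
      ext s i
      simp [brownianPath, bridgePath, Φ]
    simp only [S, Set.mem_ofPred_eq, Set.mem_inter_iff, Set.mem_preimage, ← this]
    rfl
  have h2 : ∀ y, brownianBridgeMeasure β x y A = ENNReal.ofReal (heatKernel β x y) *
      (wienerD d).map (bridgePath β 0 0) ((fun f ↦ Φ (f, y - x)) ⁻¹' A) := by
    intro y
    have hs : MeasurableSet ((fun f ↦ Φ (f, y - x)) ⁻¹' A) :=
      (hΦ.comp measurable_prodMk_right) hA
    rw [brownianBridgeMeasure, Measure.smul_apply, smul_eq_mul,
      Measure.map_apply (measurable_bridgePath β x y) hA,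
      Measure.map_apply hb hs]
    congr 2
    ext w
    have : bridgePath β x y w = Φ (bridgePath β 0 0 w, y - x) := by
      ext s i
      simp [bridgePath, Φ]
    simp only [Set.mem_preimage, this]
  rw [h1, ← Measure.map_apply (hb.prodMk hend) hS, joint_law hβ, hlaw,
    Measure.prod_apply_symm hS]
  have hm : Measurable fun z : EuclideanSpace ℝ (Fin d) ↦ ENNReal.ofReal (heatKernel β 0 z) := by
    unfold heatKernel; fun_prop
  rw [lintegral_withDensity_eq_lintegral_mul _ hm (measurable_measure_prodMk_right hS),
    ← lintegral_indicator hD,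
    ← lintegral_add_left_eq_self (D.indicator fun y ↦ brownianBridgeMeasure β x y A) x]
  refine lintegral_congr fun z ↦ ?_
  rw [Pi.mul_apply, Set.indicator_apply, h2]
  have hk : heatKernel β x (x + z) = heatKernel β 0 z := by simp [heatKernel]
  split_ifs with hz
  · rw [hk, add_sub_cancel_left]
    congr 2
    ext f
    simp [S, hz]
  · rw [show (fun f ↦ (f, z)) ⁻¹' S = ∅ by ext f; simp [S, hz]]
    simp

/-! ### The partition function -/

instance {d : ℕ} (β : ℝ) (x y : EuclideanSpace ℝ (Fin d)) :
    IsFiniteMeasure (brownianBridgeMeasure β x y) := by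
  unfold brownianBridgeMeasure
  exact Measure.smul_finite _ ENNReal.ofReal_ne_top

/-- The interaction `∫_0^β v(|f_s - g_s|) ds` of two paths. -/
noncomputable def pairEnergy {d : ℕ} (β : ℝ) (v : ℝ≥0 → ℝ≥0∞)
    (f g : PathSpace (Set.Icc 0 β) (EuclideanSpace ℝ (Fin d))) : ℝ≥0∞ :=
  ∫⁻ s, v ‖f.1 s - g.1 s‖₊ ∂(volume.comap (Subtype.val : Set.Icc 0 β → ℝ))

/-- The partition function `Z_N(β, Λ)` with empty boundary condition,
`(1 / N!) ∑_σ ∫_Λ dx_1 ⋯ ∫_Λ dx_N ⨂_i μ_{x_i, x_σ(i)}^{(β)} [exp (- ∑_{i < j} ∫_0^β v(|B^i - B^j|))]`.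
Here `EReal.exp` maps `-∞` to `0`. -/
noncomputable def partitionFunction {d : ℕ} (β : ℝ) (v : ℝ≥0 → ℝ≥0∞)
    (Λ : Set (EuclideanSpace ℝ (Fin d))) (N : ℕ) : ℝ≥0∞ :=
  (N.factorial : ℝ≥0∞)⁻¹ * ∑ σ : Equiv.Perm (Fin N),
    ∫⁻ x : Fin N → EuclideanSpace ℝ (Fin d),
      ∫⁻ B : Fin N → PathSpace (Set.Icc 0 β) (EuclideanSpace ℝ (Fin d)),
        EReal.exp (-((∑ i, ∑ j ∈ Finset.Ioi i, pairEnergy β v (B i) (B j) : ℝ≥0∞) : EReal))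
        ∂(Measure.pi fun i ↦ brownianBridgeMeasure β (x i) (x (σ i)))
      ∂(Measure.pi fun _ ↦ volume.restrict Λ)

/-- `α(v) = ∫_{ℝ^d} v(|x|) dx`. -/
noncomputable def potentialIntegral (d : ℕ) (v : ℝ≥0 → ℝ≥0∞) : ℝ≥0∞ :=
  ∫⁻ x : EuclideanSpace ℝ (Fin d), v ‖x‖₊

end BoseGas

open MeasureTheory
open scoped NNReal ENNReal

namespace BoseGas

/-! Every summand of `Z_{N+1}` is nonnegative, so keeping only the permutations of `0, …, N` that
fix `0` gives a lower bound. Under such a permutation particle `0` is a loop, a bridge from `x₀` to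
`x₀`, whose mass `g_β(x₀, x₀) = (4πβ)^(-d/2)` does not depend on `x₀`. The other `N` particles carry
an arbitrary permutation, so what remains is `N! Z_N` with one extra factor under the integral: the
Boltzmann factor of the interaction of the loop with the others.

Fix the other `N` paths and integrate this factor over the start `x₀ ∈ Λ` and the shape of the loop,
a measure of mass `|Λ|`. By Jensen (`mul_boltzmann_le_lintegral`) the result is at least `|Λ|` times
the exponential of minus the mean interaction. Since a loop is `x₀` plus a loop from the origin, the
interaction with one path at one time, integrated over `x₀`, is at most `α(v)` by translation
invariance. Over the time `β` and the `N` paths the mean is therefore at most `N β α(v) / |Λ|`,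
uniformly in the fixed paths (`lintegral_pairEnergy_loop_le`, `loop_lower_bound`). The factor comes
out of the integral (`permWeight_fixZero_ge`), and `N! / (N+1)! = 1 / (N+1)` gives
`partitionFunction_succ_ge`.

Finiteness holds because the integrand is bounded and `|Λ| < ∞`. Positivity follows from the bound
itself by induction from `Z_0 = 1`. The estimates are made in `[0, ∞]`, where Tonelli needs only
measurability. -/

/-! ### Boltzmann factors -/

/-- The Boltzmann factor `exp (-y)` of an energy `y ∈ [0, ∞]`. -/
noncomputable def boltzmann (y : ℝ≥0∞) : ℝ≥0∞ := EReal.exp (-(y : EReal))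

lemma measurable_boltzmann : Measurable boltzmann :=
  EReal.measurable_exp.comp measurable_coe_ennreal_ereal.neg

/-- Valid also for infinite energies: neither summand is `⊥`, so negation distributes over the sum
in `EReal`. -/
lemma boltzmann_add (a b : ℝ≥0∞) : boltzmann (a + b) = boltzmann a * boltzmann b := by
  unfold boltzmann
  rw [EReal.coe_ennreal_add, EReal.neg_add (by simp) (by simp), sub_eq_add_neg, EReal.exp_add]

lemma boltzmann_le_one (a : ℝ≥0∞) : boltzmann a ≤ 1 := by
  unfold boltzmann
  rw [EReal.exp_le_one_iff, EReal.neg_le_zero]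
  exact EReal.coe_ennreal_nonneg a

lemma boltzmann_coe (r : ℝ≥0) : boltzmann r = ENNReal.ofReal (Real.exp (-r)) := by
  unfold boltzmann
  rw [← EReal.exp_coe]
  rfl

/-- The tangent line inequality `exp (-a) (1 + a) ≤ exp (-y) + exp (-a) y`. -/
lemma boltzmann_tangent (a : ℝ≥0) (y : ℝ≥0∞) :
    boltzmann a * (1 + a) ≤ boltzmann y + boltzmann a * y := by
  rw [boltzmann_coe]
  induction y with
  -- For `y = ∞` the right side is infinite, because `exp (-a) > 0`.
  | top => simp [ENNReal.mul_top, Real.exp_pos]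
  | coe y =>
    rw [boltzmann_coe, ← ENNReal.ofReal_coe_nnreal, ← ENNReal.ofReal_coe_nnreal,
      ← ENNReal.ofReal_one, ← ENNReal.ofReal_add (by simp) (by simp),
      ← ENNReal.ofReal_mul (by positivity), ← ENNReal.ofReal_mul (by positivity),
      ← ENNReal.ofReal_add (by positivity) (by positivity)]
    refine ENNReal.ofReal_le_ofReal ?_
    -- This is `1 + (a - y) ≤ exp (a - y)` multiplied by `exp (-a)`; the negative term sits on the
    -- other side of the claim to avoid truncated subtraction.
    have h := mul_le_mul_of_nonneg_left (Real.add_one_le_exp (a - y : ℝ)) (Real.exp_nonneg (-a))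
    rw [← Real.exp_add, show -(a : ℝ) + (a - y) = -y by ring] at h
    linarith

/-- Jensen's inequality for `y ↦ exp (-y)` and a finite measure. -/
lemma mul_boltzmann_le_lintegral {α : Type*} [MeasurableSpace α] (μ : Measure α)
    [IsFiniteMeasure μ] {f : α → ℝ≥0∞} (hf : Measurable f) (a : ℝ≥0)
    (hfa : ∫⁻ x, f x ∂μ ≤ a * μ Set.univ) :
    boltzmann a * μ Set.univ ≤ ∫⁻ x, boltzmann (f x) ∂μ := by
  have h1 : ∫⁻ _, boltzmann a * (1 + a) ∂μ ≤ ∫⁻ x, (boltzmann (f x) + boltzmann a * f x) ∂μ :=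
    lintegral_mono fun x ↦ boltzmann_tangent a (f x)
  rw [lintegral_const, lintegral_add_right _ (hf.const_mul _), lintegral_const_mul _ hf,
    mul_assoc, add_mul, one_mul, mul_add] at h1
  -- After integration of the tangent line at the bound `a` for the mean, this term occurs on both
  -- sides; it can be cancelled only because it is finite.
  have h2 : boltzmann a * (a * μ Set.univ) ≠ ∞ :=
    ENNReal.mul_ne_top ((boltzmann_le_one a).trans_lt (by simp)).ne
      (ENNReal.mul_ne_top (by simp) (measure_ne_top _ _))
  exact (ENNReal.add_le_add_iff_right h2).1
    (h1.trans (add_le_add_right (mul_le_mul_right hfa _) _))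

/-! ### Product measures -/

/-- Used to take the masses `g_β(x_i, x_σ(i))` out of the product of the bridge measures. Finite
constants keep the scaled factors finite, so that values on boxes determine the product. -/
lemma pi_smul_measure {ι : Type*} [Fintype ι] {X : ι → Type*} [∀ i, MeasurableSpace (X i)]
    (c : ι → ℝ≥0∞) (hc : ∀ i, c i ≠ ∞) (μ : ∀ i, Measure (X i)) [∀ i, IsFiniteMeasure (μ i)] :
    Measure.pi (fun i ↦ c i • μ i) = (∏ i, c i) • Measure.pi μ := by
  have := fun i ↦ Measure.smul_finite (μ i) (hc i)
  refine Measure.pi_eq fun s _ ↦ ?_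
  simp [Measure.pi_pi, Finset.prod_mul_distrib]

/-- Tonelli for the coordinate `0`. It separates the added particle, both in the starting points and
in the Brownian motions. -/
lemma lintegral_pi_cons {α : Type*} [MeasurableSpace α] (μ : Measure α) [SigmaFinite μ] {n : ℕ}
    {f : (Fin (n + 1) → α) → ℝ≥0∞} (hf : Measurable f) :
    ∫⁻ x, f x ∂(Measure.pi fun _ ↦ μ) =
      ∫⁻ a, ∫⁻ y, f (Fin.cons a y) ∂(Measure.pi fun _ ↦ μ) ∂μ := by
  have h := measurePreserving_piFinSuccAbove (fun _ : Fin (n + 1) ↦ μ) 0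
  rw [← h.symm.lintegral_comp hf, lintegral_prod _ (by
    exact (hf.comp (MeasurableEquiv.measurable _)).aemeasurable)]
  simp [MeasurableEquiv.piFinSuccAbove, Fin.insertNthEquiv]

lemma measurable_fin_cons {α γ : Type*} [MeasurableSpace α] [MeasurableSpace γ] {n : ℕ}
    {f : γ → α} {g : γ → Fin n → α} (hf : Measurable f) (hg : Measurable g) :
    Measurable fun c ↦ (Fin.cons (f c) (g c) : Fin (n + 1) → α) := by
  refine measurable_pi_lambda _ fun i ↦ Fin.cases ?_ (fun i ↦ ?_) i
  · exact hf
  · exact (measurable_pi_apply i).comp hg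

/-- In the application `a` is the start of the loop, `c` its Brownian motion and `e` the Brownian
motions of the other particles; `f` is the Boltzmann factor of the loop with the others and `g` that
of the others among themselves. Integrating over the loop first isolates the quantity bounded by
Jensen. -/
lemma lintegral_lintegral_lintegral_mul_swap {α γ δ : Type*} [MeasurableSpace α]
    [MeasurableSpace γ] [MeasurableSpace δ] (μ : Measure α) (ν : Measure γ) (ρ : Measure δ)
    [SFinite μ] [SFinite ν] [SFinite ρ] {f : α → γ → δ → ℝ≥0∞} {g : δ → ℝ≥0∞}
    (hf : Measurable fun q : (α × γ) × δ ↦ f q.1.1 q.1.2 q.2) (hg : Measurable g) :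
    ∫⁻ a, ∫⁻ c, ∫⁻ e, f a c e * g e ∂ρ ∂ν ∂μ =
      ∫⁻ e, (∫⁻ p, f p.1 p.2 e ∂(μ.prod ν)) * g e ∂ρ := by
  have h : Measurable fun q : (α × γ) × δ ↦ f q.1.1 q.1.2 q.2 * g q.2 :=
    hf.mul (hg.comp measurable_snd)
  have h1 := lintegral_prod (μ := μ) (ν := ν) _ (h.lintegral_prod_right' (ν := ρ)).aemeasurable
  have h2 := lintegral_lintegral_swap (μ := μ.prod ν) (ν := ρ)
    (f := fun p e ↦ f p.1 p.2 e * g e) h.aemeasurable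
  exact (h1.symm.trans h2).trans (lintegral_congr fun e ↦
    lintegral_mul_const _ (hf.comp measurable_prodMk_right))

/-! ### Measurability of the energy -/

variable {d : ℕ}

instance (β : ℝ) : IsFiniteMeasure (volume.comap (Subtype.val : Set.Icc 0 β → ℝ)) := by
  refine ⟨?_⟩
  rw [comap_subtype_coe_apply measurableSet_Icc, Set.image_univ, Subtype.range_coe]
  exact measure_Icc_lt_top

lemma comap_Icc_univ (β : ℝ) :
    volume.comap (Subtype.val : Set.Icc 0 β → ℝ) Set.univ = ENNReal.ofReal β := by
  rw [comap_subtype_coe_apply measurableSet_Icc, Set.image_univ, Subtype.range_coe,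
    Real.volume_Icc, sub_zero]

/-- The `σ`-algebra on paths gives measurability only at each fixed time; continuity in time makes
it joint, as Tonelli for the time integral requires. -/
lemma measurable_path_eval (β : ℝ) : Measurable fun p : Set.Icc 0 β ×
    PathSpace (Set.Icc 0 β) (EuclideanSpace ℝ (Fin d)) ↦ p.2.1 p.1 :=
  measurable_uncurry_of_continuous_of_measurable
    (u := fun s (f : PathSpace (Set.Icc 0 β) (EuclideanSpace ℝ (Fin d))) ↦ f.1 s)
    (fun f ↦ f.2) fun s ↦ (measurable_pi_apply s).comp measurable_subtype_coe

lemma measurable_pairEnergy {α : Type*} [MeasurableSpace α] {β : ℝ} {v : ℝ≥0 → ℝ≥0∞}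
    (hv : Measurable v) {f g : α → PathSpace (Set.Icc 0 β) (EuclideanSpace ℝ (Fin d))}
    (hf : Measurable f) (hg : Measurable g) :
    Measurable fun a ↦ pairEnergy β v (f a) (g a) := by
  unfold pairEnergy
  have h := measurable_path_eval (d := d) β
  have h1 : Measurable fun q : α × Set.Icc 0 β ↦ (f q.1).1 q.2 :=
    h.comp (measurable_snd.prodMk (hf.comp measurable_fst))
  have h2 : Measurable fun q : α × Set.Icc 0 β ↦ (g q.1).1 q.2 :=
    h.comp (measurable_snd.prodMk (hg.comp measurable_fst))
  exact (hv.comp (h1.sub h2).nnnorm).lintegral_prod_right'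

lemma measurable_bridgePath_comp {α : Type*} [MeasurableSpace α] (β : ℝ)
    {x y : α → EuclideanSpace ℝ (Fin d)} {w : α → Fin d → PathSpace ℝ≥0 ℝ}
    (hx : Measurable x) (hy : Measurable y) (hw : Measurable w) :
    Measurable fun a ↦ bridgePath β (x a) (y a) (w a) := by
  refine Measurable.subtype_mk (measurable_pi_lambda _ fun s ↦ ?_)
  have hb := fun t ↦ (measurable_bmValue (d := d) t).comp hw
  exact (hx.add ((hy.sub hx).const_smul (s.1 / β))).add
    ((hb _).sub ((hb _).const_smul (s.1 / β)))

/-- The total interaction energy of a family of paths. -/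
noncomputable def totalEnergy (β : ℝ) (v : ℝ≥0 → ℝ≥0∞) {N : ℕ}
    (B : Fin N → PathSpace (Set.Icc 0 β) (EuclideanSpace ℝ (Fin d))) : ℝ≥0∞ :=
  ∑ i, ∑ j ∈ Finset.Ioi i, pairEnergy β v (B i) (B j)

lemma measurable_totalEnergy (β : ℝ) {v : ℝ≥0 → ℝ≥0∞} (hv : Measurable v) {N : ℕ} :
    Measurable (totalEnergy (d := d) (N := N) β v) := by
  unfold totalEnergy
  exact Finset.measurable_fun_sum _ fun i _ ↦ Finset.measurable_fun_sum _ fun j _ ↦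
    measurable_pairEnergy hv (measurable_pi_apply i) (measurable_pi_apply j)

lemma totalEnergy_cons (β : ℝ) (v : ℝ≥0 → ℝ≥0∞) {N : ℕ}
    (b : PathSpace (Set.Icc 0 β) (EuclideanSpace ℝ (Fin d)))
    (B : Fin N → PathSpace (Set.Icc 0 β) (EuclideanSpace ℝ (Fin d))) :
    totalEnergy β v (Fin.cons b B : Fin (N + 1) → _) =
      ∑ i, pairEnergy β v b (B i) + totalEnergy β v B := by
  unfold totalEnergy
  rw [Fin.sum_univ_succ]
  simp only [Fin.sum_Ioi_zero, Fin.sum_Ioi_succ, Fin.cons_zero, Fin.cons_succ]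

/-! ### The contribution of a permutation -/

/-- The Brownian bridges from `x i` to `x (σ i)`. -/
noncomputable def bridges (β : ℝ) {N : ℕ} (σ : Equiv.Perm (Fin N))
    (x : Fin N → EuclideanSpace ℝ (Fin d)) (w : Fin N → Fin d → PathSpace ℝ≥0 ℝ) :
    Fin N → PathSpace (Set.Icc 0 β) (EuclideanSpace ℝ (Fin d)) :=
  fun i ↦ bridgePath β (x i) (x (σ i)) (w i)

lemma measurable_bridges {α : Type*} [MeasurableSpace α] (β : ℝ) {N : ℕ}
    (σ : Equiv.Perm (Fin N)) {x : α → Fin N → EuclideanSpace ℝ (Fin d)}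
    {w : α → Fin N → Fin d → PathSpace ℝ≥0 ℝ} (hx : Measurable x) (hw : Measurable w) :
    Measurable fun a ↦ bridges β σ (x a) (w a) :=
  measurable_pi_lambda _ fun i ↦ measurable_bridgePath_comp β
    ((measurable_pi_apply i).comp hx) ((measurable_pi_apply (σ i)).comp hx)
    ((measurable_pi_apply i).comp hw)

lemma measurable_boltzmann_bridges {α : Type*} [MeasurableSpace α] (β : ℝ) {v : ℝ≥0 → ℝ≥0∞}
    (hv : Measurable v) {N : ℕ} (σ : Equiv.Perm (Fin N))
    {x : α → Fin N → EuclideanSpace ℝ (Fin d)} {w : α → Fin N → Fin d → PathSpace ℝ≥0 ℝ}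
    (hx : Measurable x) (hw : Measurable w) :
    Measurable fun a ↦ boltzmann (totalEnergy β v (bridges β σ (x a) (w a))) :=
  measurable_boltzmann.comp ((measurable_totalEnergy β hv).comp (measurable_bridges β σ hx hw))

/-- The mean Boltzmann factor of the bridges from `x i` to `x (σ i)`. -/
noncomputable def meanBoltzmann (β : ℝ) (v : ℝ≥0 → ℝ≥0∞) {N : ℕ} (σ : Equiv.Perm (Fin N))
    (x : Fin N → EuclideanSpace ℝ (Fin d)) : ℝ≥0∞ :=
  ∫⁻ w, boltzmann (totalEnergy β v (bridges β σ x w)) ∂(Measure.pi fun _ ↦ wienerD d)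

lemma measurable_meanBoltzmann (β : ℝ) {v : ℝ≥0 → ℝ≥0∞} (hv : Measurable v) {N : ℕ}
    (σ : Equiv.Perm (Fin N)) : Measurable (meanBoltzmann (d := d) β v σ) :=
  (measurable_boltzmann_bridges β hv σ measurable_fst measurable_snd).lintegral_prod_right'

/-- The product of the total masses of the bridge measures. -/
noncomputable def bridgeMass (β : ℝ) {N : ℕ} (σ : Equiv.Perm (Fin N))
    (x : Fin N → EuclideanSpace ℝ (Fin d)) : ℝ≥0∞ :=
  ∏ i, ENNReal.ofReal (heatKernel β (x i) (x (σ i)))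

lemma measurable_bridgeMass (β : ℝ) {N : ℕ} (σ : Equiv.Perm (Fin N)) :
    Measurable (bridgeMass (d := d) β σ) := by
  unfold bridgeMass heatKernel
  fun_prop

/-- The contribution of the permutation `σ` to `N! Z_N(β, Λ)`. -/
noncomputable def permWeight (β : ℝ) (v : ℝ≥0 → ℝ≥0∞) (Λ : Set (EuclideanSpace ℝ (Fin d))) {N : ℕ}
    (σ : Equiv.Perm (Fin N)) : ℝ≥0∞ :=
  ∫⁻ x, bridgeMass β σ x * meanBoltzmann β v σ x ∂(Measure.pi fun _ ↦ volume.restrict Λ)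

/-- The bridge measures vary with `x`, but all are scaled images of the one probability measure
`wienerD d`. Pulling back to it moves the dependence on `x` into the integrand, so the integrals
over points and paths can be interchanged by Tonelli. -/
lemma partitionFunction_eq (β : ℝ) {v : ℝ≥0 → ℝ≥0∞} (hv : Measurable v)
    (Λ : Set (EuclideanSpace ℝ (Fin d))) (N : ℕ) :
    partitionFunction β v Λ N =
      (N.factorial : ℝ≥0∞)⁻¹ * ∑ σ : Equiv.Perm (Fin N), permWeight β v Λ σ := by
  unfold partitionFunction permWeight meanBoltzmann
  congr 1
  refine Finset.sum_congr rfl fun σ _ ↦ lintegral_congr fun x ↦ ?_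
  unfold brownianBridgeMeasure
  rw [pi_smul_measure _ (fun _ ↦ ENNReal.ofReal_ne_top), lintegral_smul_measure, smul_eq_mul,
    ← Measure.pi_map_pi fun i ↦ (measurable_bridgePath β (x i) (x (σ i))).aemeasurable]
  congr 1
  exact lintegral_map (measurable_boltzmann.comp (measurable_totalEnergy β hv))
    (measurable_pi_lambda _ fun i ↦ (measurable_bridgePath β _ _).comp (measurable_pi_apply i))

lemma heatKernel_le {β : ℝ} (hβ : 0 < β) (x y : EuclideanSpace ℝ (Fin d)) :
    heatKernel β x y ≤ (4 * Real.pi * β) ^ (-(d : ℝ) / 2) := by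
  unfold heatKernel
  refine mul_le_of_le_one_right (by positivity) (Real.exp_le_one_iff.2 ?_)
  rw [neg_mul, neg_nonpos]
  positivity

lemma heatKernel_self (β : ℝ) (x : EuclideanSpace ℝ (Fin d)) :
    heatKernel β x x = (4 * Real.pi * β) ^ (-(d : ℝ) / 2) := by
  simp [heatKernel]

/-- The heat kernel is bounded by its value on the diagonal and the Boltzmann factor by `1`, on a
domain of finite measure. -/
lemma permWeight_lt_top {β : ℝ} (hβ : 0 < β) (v : ℝ≥0 → ℝ≥0∞)
    {Λ : Set (EuclideanSpace ℝ (Fin d))} (hΛ : volume Λ < ∞) {N : ℕ} (σ : Equiv.Perm (Fin N)) :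
    permWeight β v Λ σ < ∞ := by
  have := isFiniteMeasure_restrict.2 hΛ.ne
  have h : permWeight β v Λ σ ≤
      ∫⁻ _, ENNReal.ofReal ((4 * Real.pi * β) ^ (-(d : ℝ) / 2)) ^ N
        ∂(Measure.pi fun _ : Fin N ↦ volume.restrict Λ) := by
    refine lintegral_mono fun x ↦ (mul_le_mul' (Finset.prod_le_pow_card _ _ _ fun i _ ↦
      ENNReal.ofReal_le_ofReal (heatKernel_le hβ _ _)) (lintegral_mono fun w ↦
        boltzmann_le_one _)).trans_eq ?_
    simp
  refine h.trans_lt ?_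
  rw [lintegral_const]
  exact ENNReal.mul_lt_top (ENNReal.pow_lt_top ENNReal.ofReal_lt_top) (measure_lt_top _ _)

lemma partitionFunction_lt_top {β : ℝ} (hβ : 0 < β) {v : ℝ≥0 → ℝ≥0∞} (hv : Measurable v)
    {Λ : Set (EuclideanSpace ℝ (Fin d))} (hΛ : volume Λ < ∞) (N : ℕ) :
    partitionFunction β v Λ N < ∞ := by
  rw [partitionFunction_eq β hv]
  exact ENNReal.mul_lt_top (ENNReal.inv_lt_top.2 (by exact_mod_cast N.factorial_pos))
    (ENNReal.sum_lt_top.2 fun σ _ ↦ permWeight_lt_top hβ v hΛ σ)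

lemma partitionFunction_zero (β : ℝ) (v : ℝ≥0 → ℝ≥0∞) (Λ : Set (EuclideanSpace ℝ (Fin d))) :
    partitionFunction β v Λ 0 = 1 := by
  simp [partitionFunction]

/-! ### Adding a particle -/

lemma bridgePath_self_apply (β : ℝ) (x : EuclideanSpace ℝ (Fin d)) (w : Fin d → PathSpace ℝ≥0 ℝ)
    (s : Set.Icc 0 β) : (bridgePath β x x w).1 s = x + (bridgePath β 0 0 w).1 s := by
  simp [bridgePath]

/-- Enlarging `Λ` to the whole space makes the integral translation invariant, so the bound is
uniform in `z`. -/
lemma setLIntegral_translate_le (v : ℝ≥0 → ℝ≥0∞) (Λ : Set (EuclideanSpace ℝ (Fin d)))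
    (z : EuclideanSpace ℝ (Fin d)) : ∫⁻ x in Λ, v ‖x + z‖₊ ≤ potentialIntegral d v :=
  (setLIntegral_le_lintegral _ _).trans_eq
    (lintegral_add_right_eq_self (fun x : EuclideanSpace ℝ (Fin d) ↦ v ‖x‖₊) z)

/-- The mean interaction of a uniformly distributed loop with a fixed path. -/
lemma lintegral_pairEnergy_loop_le (β : ℝ) {v : ℝ≥0 → ℝ≥0∞} (hv : Measurable v)
    (Λ : Set (EuclideanSpace ℝ (Fin d)))
    (f : PathSpace (Set.Icc 0 β) (EuclideanSpace ℝ (Fin d))) :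
    ∫⁻ p, pairEnergy β v (bridgePath β p.1 p.1 p.2) f ∂((volume.restrict Λ).prod (wienerD d)) ≤
      ENNReal.ofReal β * potentialIntegral d v := by
  have hb : Measurable fun p : EuclideanSpace ℝ (Fin d) × (Fin d → PathSpace ℝ≥0 ℝ) ↦
      bridgePath β p.1 p.1 p.2 :=
    measurable_bridgePath_comp β measurable_fst measurable_fst measurable_snd
  have he : Measurable fun p : EuclideanSpace ℝ (Fin d) × (Fin d → PathSpace ℝ≥0 ℝ) ↦
      pairEnergy β v (bridgePath β p.1 p.1 p.2) f :=
    measurable_pairEnergy hv hb measurable_const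
  rw [lintegral_prod_symm _ he.aemeasurable]
  -- The bound already holds for each fixed shape `w` of the loop; only the average over its start
  -- is used.
  have key : ∀ w : Fin d → PathSpace ℝ≥0 ℝ, ∫⁻ x in Λ, pairEnergy β v (bridgePath β x x w) f ≤
      ENNReal.ofReal β * potentialIntegral d v := by
    intro w
    unfold pairEnergy
    -- `z` is the loop from the origin minus the path `f`, so that the start `x` enters only as a
    -- translation.
    obtain ⟨z, hz, h⟩ : ∃ z : Set.Icc 0 β → EuclideanSpace ℝ (Fin d), Measurable z ∧
        ∀ x s, (bridgePath β x x w).1 s - f.1 s = x + z s :=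
      ⟨fun s ↦ (bridgePath β 0 0 w).1 s - f.1 s, ((bridgePath β 0 0 w).2.sub f.2).measurable,
        fun x s ↦ by rw [bridgePath_self_apply, add_sub_assoc]⟩
    simp only [h]
    rw [lintegral_lintegral_swap]
    · refine (lintegral_mono fun s ↦ setLIntegral_translate_le v Λ _).trans_eq ?_
      rw [lintegral_const, comap_Icc_univ, mul_comm]
    · exact (hv.comp (measurable_fst.add (hz.comp measurable_snd)).nnnorm).aemeasurable
  refine (lintegral_mono key).trans_eq ?_
  simp

/-- Integrating out a loop costs at most the factor `exp (-N β α(v) / |Λ|)`. -/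
lemma loop_lower_bound (β : ℝ) {v : ℝ≥0 → ℝ≥0∞} (hv : Measurable v)
    {Λ : Set (EuclideanSpace ℝ (Fin d))} (hΛ : volume Λ < ∞) {N : ℕ} (a : ℝ≥0)
    (ha : N * (ENNReal.ofReal β * potentialIntegral d v) ≤ a * volume Λ)
    (B : Fin N → PathSpace (Set.Icc 0 β) (EuclideanSpace ℝ (Fin d))) :
    boltzmann a * volume Λ ≤ ∫⁻ p, boltzmann (∑ i, pairEnergy β v (bridgePath β p.1 p.1 p.2) (B i))
      ∂((volume.restrict Λ).prod (wienerD d)) := by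
  have := isFiniteMeasure_restrict.2 hΛ.ne
  have hb : Measurable fun p : EuclideanSpace ℝ (Fin d) × (Fin d → PathSpace ℝ≥0 ℝ) ↦
      bridgePath β p.1 p.1 p.2 :=
    measurable_bridgePath_comp β measurable_fst measurable_fst measurable_snd
  have he : ∀ i, Measurable fun p : EuclideanSpace ℝ (Fin d) × (Fin d → PathSpace ℝ≥0 ℝ) ↦
      pairEnergy β v (bridgePath β p.1 p.1 p.2) (B i) := fun i ↦
    measurable_pairEnergy hv hb measurable_const
  have hm : ((volume.restrict Λ).prod (wienerD d)) Set.univ = volume Λ := by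
    simp [← Set.univ_prod_univ, Measure.prod_prod]
  have h := mul_boltzmann_le_lintegral ((volume.restrict Λ).prod (wienerD d))
    (f := fun p ↦ ∑ i, pairEnergy β v (bridgePath β p.1 p.1 p.2) (B i))
    (Finset.measurable_fun_sum _ fun i _ ↦ he i) a ?_
  · rwa [hm] at h
  · rw [hm, lintegral_finsetSum _ fun i _ ↦ he i]
    refine le_trans ?_ ha
    refine (Finset.sum_le_sum fun i _ ↦ lintegral_pairEnergy_loop_le β hv Λ (B i)).trans_eq ?_
    simp

/-- The permutation of `0, …, N` fixing `0` and acting as `σ` on the successors. -/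
def fixZero {N : ℕ} (σ : Equiv.Perm (Fin N)) : Equiv.Perm (Fin (N + 1)) :=
  Equiv.Perm.decomposeFin.symm (0, σ)

lemma fixZero_zero {N : ℕ} (σ : Equiv.Perm (Fin N)) : fixZero σ 0 = 0 := by simp [fixZero]

lemma fixZero_succ {N : ℕ} (σ : Equiv.Perm (Fin N)) (i : Fin N) :
    fixZero σ i.succ = (σ i).succ := by simp [fixZero]

lemma fixZero_injective {N : ℕ} : Function.Injective (fixZero (N := N)) := fun σ τ h ↦ by
  simpa [fixZero] using h

lemma bridges_cons (β : ℝ) {N : ℕ} (σ : Equiv.Perm (Fin N)) (x₀ : EuclideanSpace ℝ (Fin d))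
    (x : Fin N → EuclideanSpace ℝ (Fin d)) (w₀ : Fin d → PathSpace ℝ≥0 ℝ)
    (w : Fin N → Fin d → PathSpace ℝ≥0 ℝ) :
    bridges β (fixZero σ) (Fin.cons x₀ x) (Fin.cons w₀ w) =
      Fin.cons (bridgePath β x₀ x₀ w₀) (bridges β σ x w) := by
  ext1 i
  refine Fin.cases ?_ (fun i ↦ ?_) i <;> simp [bridges, fixZero_zero, fixZero_succ]

/-- The loop contributes the heat kernel on the diagonal, which is constant in `x₀`; this is the
source of `(4πβ)^(-d/2)` in the theorem. -/
lemma bridgeMass_cons (β : ℝ) {N : ℕ} (σ : Equiv.Perm (Fin N)) (x₀ : EuclideanSpace ℝ (Fin d))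
    (x : Fin N → EuclideanSpace ℝ (Fin d)) :
    bridgeMass β (fixZero σ) (Fin.cons x₀ x) =
      ENNReal.ofReal ((4 * Real.pi * β) ^ (-(d : ℝ) / 2)) * bridgeMass β σ x := by
  simp [bridgeMass, Fin.prod_univ_succ, fixZero_zero, fixZero_succ, heatKernel_self]

lemma meanBoltzmann_cons (β : ℝ) {v : ℝ≥0 → ℝ≥0∞} (hv : Measurable v) {N : ℕ}
    (σ : Equiv.Perm (Fin N)) (x₀ : EuclideanSpace ℝ (Fin d))
    (x : Fin N → EuclideanSpace ℝ (Fin d)) :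
    meanBoltzmann β v (fixZero σ) (Fin.cons x₀ x) = ∫⁻ w₀, ∫⁻ w,
      boltzmann (∑ i, pairEnergy β v (bridgePath β x₀ x₀ w₀) (bridges β σ x w i)) *
        boltzmann (totalEnergy β v (bridges β σ x w))
      ∂(Measure.pi fun _ ↦ wienerD d) ∂(wienerD d) := by
  unfold meanBoltzmann
  refine (lintegral_pi_cons (wienerD d) (measurable_boltzmann_bridges β hv (fixZero σ)
    measurable_const measurable_id)).trans ?_
  refine lintegral_congr fun w₀ ↦ lintegral_congr fun w ↦ ?_
  rw [id, bridges_cons, totalEnergy_cons, boltzmann_add]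

/-- With the Brownian motions of the other particles integrated last, `loop_lower_bound` applies for
each value of them, and its constant does not depend on them. -/
lemma setLIntegral_meanBoltzmann_cons_ge (β : ℝ) {v : ℝ≥0 → ℝ≥0∞} (hv : Measurable v)
    {Λ : Set (EuclideanSpace ℝ (Fin d))} (hΛ : volume Λ < ∞) {N : ℕ} (a : ℝ≥0)
    (ha : N * (ENNReal.ofReal β * potentialIntegral d v) ≤ a * volume Λ)
    (σ : Equiv.Perm (Fin N)) (x : Fin N → EuclideanSpace ℝ (Fin d)) :
    boltzmann a * volume Λ * meanBoltzmann β v σ x ≤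
      ∫⁻ x₀ in Λ, meanBoltzmann β v (fixZero σ) (Fin.cons x₀ x) := by
  have hB := measurable_boltzmann_bridges β hv σ (measurable_const (a := x)) measurable_id
  have hb : ∀ i, Measurable fun q : (EuclideanSpace ℝ (Fin d) × (Fin d → PathSpace ℝ≥0 ℝ)) ×
      (Fin N → Fin d → PathSpace ℝ≥0 ℝ) ↦
      pairEnergy β v (bridgePath β q.1.1 q.1.1 q.1.2) (bridges β σ x q.2 i) := fun i ↦
    measurable_pairEnergy hv
      (measurable_bridgePath_comp β (measurable_fst.comp measurable_fst)
        (measurable_fst.comp measurable_fst) (measurable_snd.comp measurable_fst))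
      ((measurable_pi_apply i).comp (measurable_bridges β σ measurable_const measurable_snd))
  have hI := measurable_boltzmann.comp (Finset.measurable_fun_sum Finset.univ fun i _ ↦ hb i)
  have h := lintegral_lintegral_lintegral_mul_swap (volume.restrict Λ) (wienerD d)
    (Measure.pi fun _ : Fin N ↦ wienerD d)
    (f := fun x₀ w₀ w ↦
      boltzmann (∑ i, pairEnergy β v (bridgePath β x₀ x₀ w₀) (bridges β σ x w i))) hI hB
  simp_rw [meanBoltzmann_cons β hv]
  refine le_trans ?_ h.ge
  refine (lintegral_const_mul (boltzmann a * volume Λ) hB).symm.trans_le ?_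
  exact lintegral_mono fun w ↦ mul_le_mul_left (loop_lower_bound β hv hΛ a ha _) _

lemma permWeight_fixZero_ge (β : ℝ) {v : ℝ≥0 → ℝ≥0∞} (hv : Measurable v)
    {Λ : Set (EuclideanSpace ℝ (Fin d))} (hΛ : volume Λ < ∞) {N : ℕ} (a : ℝ≥0)
    (ha : N * (ENNReal.ofReal β * potentialIntegral d v) ≤ a * volume Λ)
    (σ : Equiv.Perm (Fin N)) :
    ENNReal.ofReal ((4 * Real.pi * β) ^ (-(d : ℝ) / 2)) * (boltzmann a * volume Λ) *
      permWeight β v Λ σ ≤ permWeight β v Λ (fixZero σ) := by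
  have := isFiniteMeasure_restrict.2 hΛ.ne
  have hW : ∀ {M : ℕ} (τ : Equiv.Perm (Fin M)), Measurable fun x ↦
      bridgeMass (d := d) β τ x * meanBoltzmann β v τ x := fun τ ↦
    (measurable_bridgeMass β τ).mul (measurable_meanBoltzmann β hv τ)
  unfold permWeight
  have h := (hW (fixZero σ)).comp (measurable_fin_cons measurable_fst measurable_snd)
  -- The order is exchanged so that `x₀` is integrated first, with the other starting points fixed.
  rw [lintegral_pi_cons _ (hW (fixZero σ)), lintegral_lintegral_swap (by exact h.aemeasurable),
    ← lintegral_const_mul _ (hW σ)]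
  refine lintegral_mono fun x ↦ ?_
  have hx : Measurable fun x₀ ↦ meanBoltzmann β v (fixZero σ) (Fin.cons x₀ x) :=
    (measurable_meanBoltzmann β hv (fixZero σ)).comp
      (measurable_fin_cons measurable_id measurable_const)
  simp_rw [bridgeMass_cons]
  rw [lintegral_const_mul _ hx, mul_assoc (ENNReal.ofReal _),
    mul_left_comm _ (bridgeMass β σ x), mul_assoc (ENNReal.ofReal _)]
  exact mul_le_mul_right (mul_le_mul_right
    (setLIntegral_meanBoltzmann_cons_ge β hv hΛ a ha σ x) _) _

/-- Here `a` stands for `N β α(v) / |Λ|` or any larger number; `ha` is written as a product to avoid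
division in `[0, ∞]`. The factor `1 / (N + 1)` is the quotient of the factorials. -/
lemma partitionFunction_succ_ge (β : ℝ) {v : ℝ≥0 → ℝ≥0∞} (hv : Measurable v)
    {Λ : Set (EuclideanSpace ℝ (Fin d))} (hΛ : volume Λ < ∞) {N : ℕ} (a : ℝ≥0)
    (ha : N * (ENNReal.ofReal β * potentialIntegral d v) ≤ a * volume Λ) :
    ENNReal.ofReal ((4 * Real.pi * β) ^ (-(d : ℝ) / 2)) * (boltzmann a * volume Λ) *
      ((N + 1 : ℕ) : ℝ≥0∞)⁻¹ * partitionFunction β v Λ N ≤ partitionFunction β v Λ (N + 1) := by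
  set C := ENNReal.ofReal ((4 * Real.pi * β) ^ (-(d : ℝ) / 2)) * (boltzmann a * volume Λ)
  have h1 : C * ∑ σ : Equiv.Perm (Fin N), permWeight β v Λ σ ≤
      ∑ σ : Equiv.Perm (Fin (N + 1)), permWeight β v Λ σ := by
    rw [Finset.mul_sum]
    refine (Finset.sum_le_sum fun σ _ ↦ permWeight_fixZero_ge β hv hΛ a ha σ).trans ?_
    -- Distinct `σ` give distinct permutations fixing `0`, so their weights form a partial sum; the
    -- permutations that move `0` are dropped.
    rw [← Finset.sum_image (g := fixZero) (f := permWeight β v Λ)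
      fun σ _ τ _ h ↦ fixZero_injective h]
    exact Finset.sum_le_sum_of_subset (Finset.subset_univ _)
  rw [partitionFunction_eq β hv, partitionFunction_eq β hv, Nat.factorial_succ, Nat.cast_mul,
    ENNReal.mul_inv (Or.inr (by simp)) (Or.inl (by simp))]
  calc _ = ((N + 1 : ℕ) : ℝ≥0∞)⁻¹ * (N.factorial : ℝ≥0∞)⁻¹ *
        (C * ∑ σ : Equiv.Perm (Fin N), permWeight β v Λ σ) := by ring
    _ ≤ _ := mul_le_mul_right h1 _

end BoseGas

/-! ### Positivity by induction, and passage from `[0, ∞]` to real quotients. -/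

theorem lemma3p4 (d : ℕ) (β : ℝ) (hβ : 0 < β)
    (v : ℝ≥0 → ℝ≥0∞) (hv : Measurable v) (hα : BoseGas.potentialIntegral d v < ∞)
    (Λ : Set (EuclideanSpace ℝ (Fin d))) (hΛ : MeasurableSet Λ)
    (hΛ_pos : 0 < volume Λ) (hΛ_fin : volume Λ < ∞) (N : ℕ) :
    (0 < BoseGas.partitionFunction β v Λ N ∧ BoseGas.partitionFunction β v Λ N < ∞) ∧
      (BoseGas.partitionFunction β v Λ (N + 1)).toReal /
          (BoseGas.partitionFunction β v Λ N).toReal ≥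
        (4 * Real.pi * β) ^ (-(d : ℝ) / 2) * (volume.real Λ / (N + 1)) *
          Real.exp (-(N * β * (BoseGas.potentialIntegral d v).toReal / volume.real Λ)) := by
  have hvol : 0 < volume.real Λ := ENNReal.toReal_pos hΛ_pos.ne' hΛ_fin.ne
  set r : ℕ → ℝ := fun M ↦ (4 * Real.pi * β) ^ (-(d : ℝ) / 2) * (volume.real Λ / (M + 1)) *
    Real.exp (-(M * β * (BoseGas.potentialIntegral d v).toReal / volume.real Λ)) with hr
  have hr0 : ∀ M, 0 < r M := fun M ↦ by simp only [hr]; positivity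
  have step : ∀ M, ENNReal.ofReal (r M) * BoseGas.partitionFunction β v Λ M ≤
      BoseGas.partitionFunction β v Λ (M + 1) := fun M ↦ by
    -- With this choice of `a` the hypothesis of `partitionFunction_succ_ge` on the mean interaction
    -- is an equality.
    obtain ⟨a, ha⟩ : ∃ a : ℝ≥0,
        (a : ℝ) = M * β * (BoseGas.potentialIntegral d v).toReal / volume.real Λ :=
      CanLift.prf _ (by positivity)
    have hΛr : volume Λ = ENNReal.ofReal (volume.real Λ) := (ENNReal.ofReal_toReal hΛ_fin.ne).symm
    have h := BoseGas.partitionFunction_succ_ge β hv hΛ_fin (N := M) a ?_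
    · rw [BoseGas.boltzmann_coe, hΛr, ← ENNReal.ofReal_natCast,
        ← ENNReal.ofReal_inv_of_pos (by positivity), ← ENNReal.ofReal_mul (by positivity),
        ← ENNReal.ofReal_mul (by positivity), ← ENNReal.ofReal_mul (by positivity)] at h
      convert h using 3
      simp only [hr, ha]
      push_cast
      ring
    · rw [← ENNReal.ofReal_coe_nnreal, hΛr, ← ENNReal.ofReal_mul a.coe_nonneg, ha,
        div_mul_cancel₀ _ hvol.ne', mul_assoc, ENNReal.ofReal_mul (by positivity),
        ENNReal.ofReal_mul hβ.le, ENNReal.ofReal_toReal hα.ne, ENNReal.ofReal_natCast]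
  have hfin := BoseGas.partitionFunction_lt_top hβ hv hΛ_fin
  -- The multiplicative bound `step` involves no division, so it propagates positivity from `Z_0 =
  -- 1`; only then is it turned into a bound for the quotient.
  have hpos : ∀ M, 0 < BoseGas.partitionFunction β v Λ M := fun M ↦ by
    induction M with
    | zero => simp [BoseGas.partitionFunction_zero]
    | succ M ih =>
      exact (ENNReal.mul_pos (ENNReal.ofReal_pos.2 (hr0 M)).ne' ih.ne').trans_le (step M)
  refine ⟨⟨hpos N, hfin N⟩, ?_⟩
  have h := ENNReal.toReal_mono (hfin (N + 1)).ne (step N)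
  rw [ENNReal.toReal_mul, ENNReal.toReal_ofReal (hr0 N).le] at h
  rw [ge_iff_le, le_div_iff₀ (ENNReal.toReal_pos (hpos N).ne' (hfin N).ne)]
  exact h
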